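/- There is an absolute constant $c>0$ such that the following holds. Setting. Let $d\ge 1$, let $\xi$ be a random element, and let $f_\xi:\mathbb R^d\to\mathbb R$ be random losses such that $\mathbb E[f_\xi(x)]$ exists and is finite for every $x$. Let $f(x)=\mathbb E[f_\xi(x)]$ and let $x^*$ be a minimizer of $f$. All vector norms are Euclidean, and matrix norms are operator norms. Assume: (A1) $f_\xi$ is twice differentiable; with $\Sigma=\mathbb E[\nabla^2 f_\xi(x^*)]$ and $\kappa_1\le\dots\le\kappa_d$ its eigenvalues, $\mu:=\kappa_1>0$, and $L:=\kappa_d$. (A2) with $\overline L>0$: $f$ is twice differentiable and $\|\nabla^2 f(x)-\nabla^2 f(x^*)\|\le\overline L\,\|x-x^*\|$ for all $x$. (A3') For some $\sigma,L_f>0$ and $L_\xi=\sup_{x\ne x^*}\|\nabla f_\xi(x)-\nabla f_\xi(x^*)\|/\|x-x^*\|$, $$\sup_{\|v\|=1}\mathbb E\big[\exp(|v^\top\nabla f_\xi(x^*)|/\sigma)\big]\le 2,\qquad \mathbb E\big[\exp(L_\xi/L_f)\big]\le 2 .$$ Algorithm. Let $\xi_{ti}$ ($t\ge1$, $1\le i\le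 B$, $B\ge 1$) be i.i.d. copies of $\xi$ and $g_{\eta_t}(x)=\frac1B\sum_{i=1}^B f_{\xi_{ti}}(x)$. Given a deterministic $x_1\in\mathbb R^d$, $m_1=0$, $\gamma\in[0,1)$ and $\alpha>0$, let $$m_{t+1}=\gamma m_t+(1-\gamma)\nabla g_{\eta_t}(x_t),\qquad x_{t+1}=x_t-\alpha m_{t+1},$$ and $\widetilde m_{t+1}=(1-\gamma)\sum_{j=1}^t\gamma^{t-j}\Sigma(x_j-x^*)$. Let $\lambda$ be the spectral radius of $\Gamma=\begin{pmatrix}\gamma I&(1-\gamma)\Sigma\\-\alpha\gamma I&I-\alpha(1-\gamma)\Sigma\end{pmatrix}$, let $\Delta=\min_k|(\gamma+1-\alpha(1-\gamma)\kappa_k)^2-4\gamma|$, assumed positive, and $M=\frac{4}{\sqrt\Delta}\big(2(1-\gamma)(1+\alpha L+L)+3\alpha\gamma\big)$. Theorem. Let $\delta\in(0,1]$ and let $T\ge1$ be an integer. Assume $\alpha L<2(1+\gamma)/(1-\gamma)$, $$6\sqrt2\,c\,(2\log T+4d)\,M\Big(\frac{2L_f}{\lambda^{1-\delta}\sqrt\delta\,(1-\lambda)^{1/2}}+\frac{3\overline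 L M\alpha\sigma}{(1-\lambda)^{3/2}}\Big)\alpha\le\sqrt B,$$ and $\|x_1-x^*\|\le\dfrac{\delta(1-\lambda)\lambda^{1-\delta}}{36M^2\alpha\overline L}$. Then with probability at least $1-2/T$, simultaneously for all $1\le t\le T$, $$\sqrt{\|\widetilde m_{t+1}\|^2+\|x_{t+1}-x^*\|^2}\le\frac{3\sqrt2\,c\,(2\log T+4d)\,M}{\sqrt{B(1-\lambda)}}\,\alpha\sigma+3M\|x_1-x^*\|\lambda^{(1-\delta)t}.$$ -/

import Mathlib

open MeasureTheory ProbabilityTheory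
open scoped ENNReal

noncomputable section

namespace SGDM

/-- Euclidean space of dimension `d`. -/
abbrev E (d : ℕ) : Type := EuclideanSpace ℝ (Fin d)

/-- `F` is twice differentiable on the whole space. -/
def TwiceDifferentiable {d : ℕ} (F : E d → ℝ) : Prop :=
  Differentiable ℝ F ∧ Differentiable ℝ (gradient F)

/-- The Hessian matrix of `F` at `x`: its `j`-th column is the derivative of the gradient of `F`
in the `j`-th coordinate direction. -/
def hessian {d : ℕ} (F : E d → ℝ) (x : E d) : Matrix (Fin d) (Fin d) ℝ :=
  Matrix.of fun i j => (fderiv ℝ (gradient F) x (EuclideanSpace.single j (1 : ℝ))) i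

/-- The operator on Euclidean space given by a square matrix; its norm is the operator norm
with respect to the Euclidean norm. -/
abbrev op {d : ℕ} (A : Matrix (Fin d) (Fin d) ℝ) : E d →L[ℝ] E d :=
  Matrix.toEuclideanCLM (n := Fin d) (𝕜 := ℝ) A

/-- The population loss `x ↦ 𝔼 [f_ξ(x)]`, where `ξ` has law `P`. -/
def meanLoss {d : ℕ} {S : Type*} [MeasurableSpace S] (P : Measure S) (f : S → E d → ℝ) :
    E d → ℝ :=
  fun x => ∫ s, f s x ∂P

/-- The matrix `Σ = 𝔼 [∇² f_ξ(x*)]` (entrywise expectation). -/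
def meanHessian {d : ℕ} {S : Type*} [MeasurableSpace S] (P : Measure S) (f : S → E d → ℝ)
    (xs : E d) : Matrix (Fin d) (Fin d) ℝ :=
  Matrix.of fun i j => ∫ s, hessian (f s) xs i j ∂P

/-- The random smoothness constant `L_ξ = sup_x ‖∇ f_ξ(x) - ∇ f_ξ(x*)‖ / ‖x - x*‖`, with values
in `[0, ∞]`. The point `x = x*` contributes `0 / 0 = 0`. -/
def gradLip {d : ℕ} (F : E d → ℝ) (xs : E d) : ℝ≥0∞ :=
  ⨆ x : E d, ‖gradient F x - gradient F xs‖ₑ / ‖x - xs‖ₑ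

/-- The smallest eigenvalue `κ₁` of a real symmetric matrix. -/
def minEig {d : ℕ} (A : Matrix (Fin d) (Fin d) ℝ) : ℝ := sInf (spectrum ℝ A)

/-- The largest eigenvalue `κ_d` of a real symmetric matrix. -/
def maxEig {d : ℕ} (A : Matrix (Fin d) (Fin d) ℝ) : ℝ := sSup (spectrum ℝ A)

/-- The block matrix `Γ = [[γ I, (1-γ) Σ], [-α γ I, I - α (1-γ) Σ]]`. -/
def Gam {d : ℕ} (A : Matrix (Fin d) (Fin d) ℝ) (α γ : ℝ) :
    Matrix (Fin d ⊕ Fin d) (Fin d ⊕ Fin d) ℝ :=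
  Matrix.fromBlocks (γ • 1) ((1 - γ) • A) (-(α * γ) • 1) (1 - (α * (1 - γ)) • A)

/-- The spectral radius `λ` of `Γ`: the largest modulus of its complex eigenvalues. -/
def rate {d : ℕ} (A : Matrix (Fin d) (Fin d) ℝ) (α γ : ℝ) : ℝ :=
  (spectralRadius ℂ ((Gam A α γ).map (algebraMap ℝ ℂ))).toReal

/-- `Δ = min_k |(γ + 1 - α (1-γ) κ_k)² - 4 γ|`, over the eigenvalues `κ_k` of `Σ`. -/
def gap {d : ℕ} (A : Matrix (Fin d) (Fin d) ℝ) (α γ : ℝ) : ℝ :=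
  sInf ((fun κ : ℝ => |(γ + 1 - α * (1 - γ) * κ) ^ 2 - 4 * γ|) '' spectrum ℝ A)

/-- `M = 4 Δ^{-1/2} (2 (1-γ) (1 + α L + L) + 3 α γ)`, with `L` the largest eigenvalue of `Σ`. -/
def bigM {d : ℕ} (A : Matrix (Fin d) (Fin d) ℝ) (α γ : ℝ) : ℝ :=
  4 / Real.sqrt (gap A α γ) *
    (2 * (1 - γ) * (1 + α * maxEig A + maxEig A) + 3 * α * γ)

/-- The mini-batch loss `g_η(x) = B⁻¹ ∑_{i ≤ B} f_{ξ_i}(x)` of a batch `η = (ξ_1, …, ξ_B)`. -/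
def batchLoss {d B : ℕ} {S : Type*} (f : S → E d → ℝ) (η : Fin B → S) : E d → ℝ :=
  fun x => (1 / (B : ℝ)) * ∑ i, f (η i) x

/-- The pair `(m_t, x_t)` of mini-batch SGD with momentum, for `t = 1, 2, …`, run on the batches
`η 1, η 2, …` and started at `m_1 = 0` and the given `x_1`:
`m_{t+1} = γ m_t + (1-γ) ∇g_{η_t}(x_t)` and `x_{t+1} = x_t - α m_{t+1}`.
The value at index `0` is a placeholder. -/
def iter {d B : ℕ} {S : Type*} (f : S → E d → ℝ) (α γ : ℝ) (x₁ : E d) (η : ℕ → Fin B → S) :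
    ℕ → E d × E d
  | 0 => (0, x₁)
  | 1 => (0, x₁)
  | t + 2 =>
    let p := iter f α γ x₁ η (t + 1)
    let m := γ • p.1 + (1 - γ) • gradient (batchLoss f (η (t + 1))) p.2
    (m, p.2 - α • m)

/-- `m̃_{t+1} = (1-γ) ∑_{j=1}^t γ^{t-j} Σ (x_j - x*)`, as a function of `t`, for a sequence
`x_1, x_2, …`. -/
def mTildeSucc {d : ℕ} (A : Matrix (Fin d) (Fin d) ℝ) (γ : ℝ) (xs : E d) (x : ℕ → E d)
    (t : ℕ) : E d :=
  (1 - γ) • ∑ j ∈ Finset.Icc 1 t, γ ^ (t - j) • op A (x j - xs)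

end SGDM

end

/-!
Near the minimizer, momentum SGD is a perturbation of a linear recurrence. With `A` the mean Hessian
and `y_t = x_t - x*`, the iteration reads `m_{t+1} = γ m_t + (1 - γ)(A y_t + e_t)`,
`y_{t+1} = y_t - α m_{t+1}`, where the impulse `e_t` is the gradient noise of the batch plus the
second-order remainder of the population gradient. The mean Hessian is the Hessian of the mean loss
(`meanHessian_eq_hessian_meanLoss`), so it is symmetric, and the remainder is at most
`Lbar ‖y_t‖²` (`norm_gradient_sub_hessian_le`).

In an eigenbasis of `A` the recurrence decouples into scalar ones of second order,
`p_{n+2} = (1 + γ - α (1 - γ) κ) p_{n+1} - γ p_n`, whose characteristic roots are eigenvalues of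
`Γ`. As `p_n = (r^n - s^n) / (r - s)` with `|r - s| ≥ √Δ` and `|r|, |s| ≤ λ`, all responses are at
most `M λ^n` (`response_bounds`), and Duhamel's formula turns this into operator bounds for the
averaged gradient and the position (`exists_impulse_response`).

The noise is truncated to zero when the iterate leaves a ball of prescribed radius `R_t`. This makes
it conditionally centered and sub-exponential of deterministic scale `σ + L_f R_t`, so that the
exponential moments of the filtered noise are bounded one batch at a time, by independence of the
batch from the past (`lintegral_exp_adapted_sum_le`). Averaging these moments over a ball of
directions gives the moment of the norm at the price of a factor `4^d`
(`lintegral_exp_norm_le`), whence the tail bound `measure_filtered_noise_le`.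

Finally `R_t = N + Q λ^{(1-δ)t}`, with `N` the noise floor and `Q = 3 M ‖x_1 - x*‖`, reproduces
itself: while the iterates stay within `R_t` the truncation is inactive, and `error_budget` shows
that the noise, the remainder and the initial displacement together remain below `R_t`. The loss of
`δ` in the exponent makes the convolution of `λ^n` with `λ^{(1-δ)n}` summable with constant
`1 / (δ (1 - λ))` (`sum_pow_mul_pow_le`). A union bound over the times and the two components
finishes the argument.
-/

/-! ### The scalar momentum recurrence -/

/-- The fundamental solution of `p_{n+2} = τ p_{n+1} - γ p_n`, with `p_0 = 0` and `p_1 = 1`. -/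
def momentumSeq (τ γ : ℝ) : ℕ → ℝ
  | 0 => 0
  | 1 => 1
  | n + 2 => τ * momentumSeq τ γ (n + 1) - γ * momentumSeq τ γ n

/-- The discounted sums `h_n = ∑_{k ≤ n} γ^{n-k} p_k` of the fundamental solution. -/
def discountedSeq (τ γ : ℝ) : ℕ → ℝ
  | 0 => 0
  | n + 1 => γ * discountedSeq τ γ n + momentumSeq τ γ (n + 1)

lemma momentumSeq_mul_sub {τ γ : ℝ} {r s : ℂ} (hsum : r + s = τ) (hprod : r * s = γ) (n : ℕ) :
    (momentumSeq τ γ n : ℂ) * (r - s) = r ^ n - s ^ n := by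
  induction n using Nat.twoStepInduction with
  | zero => simp [momentumSeq]
  | one => simp [momentumSeq]
  | more n h₀ h₁ =>
    simp only [momentumSeq, Complex.ofReal_sub, Complex.ofReal_mul]
    rw [← hsum, ← hprod]
    linear_combination (r + s) * h₁ - r * s * h₀

lemma exists_sum_prod (τ γ : ℝ) : ∃ r s : ℂ, r + s = τ ∧ r * s = γ := by
  obtain ⟨w, hw⟩ := IsAlgClosed.exists_pow_nat_eq ((τ : ℂ) ^ 2 - 4 * γ) (n := 2) (by norm_num)
  exact ⟨(τ + w) / 2, (τ - w) / 2, by ring, by linear_combination -hw / 4⟩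

/-- The discriminant is the squared difference of the roots. -/
lemma norm_sub_roots {τ γ : ℝ} {r s : ℂ} (hsum : r + s = τ) (hprod : r * s = γ) :
    ‖r - s‖ = √|τ ^ 2 - 4 * γ| := by
  rw [eq_comm, Real.sqrt_eq_iff_mul_self_eq (abs_nonneg _) (norm_nonneg _), ← norm_mul,
    ← Real.norm_eq_abs, ← Complex.norm_real]
  congr 1
  push_cast
  rw [← hsum, ← hprod]
  ring

/-- A root of `ρ² - τρ + γ` is either non-real, and then has modulus `√γ`, or real. -/
lemma root_cases {τ γ : ℝ} {ρ : ℂ} (h : ρ ^ 2 - τ * ρ + γ = 0) :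
    (τ = 2 * ρ.re ∧ ρ.re ^ 2 + ρ.im ^ 2 = γ) ∨
      (ρ.im = 0 ∧ ρ.re ^ 2 - τ * ρ.re + γ = 0) := by
  have hre := congrArg Complex.re h
  have him := congrArg Complex.im h
  simp [pow_two] at hre him
  by_cases h0 : ρ.im = 0
  · right
    refine ⟨h0, ?_⟩
    rw [h0] at hre
    linarith
  · left
    have : τ = 2 * ρ.re := by
      apply mul_right_cancel₀ h0
      linarith
    refine ⟨this, ?_⟩
    rw [this] at hre
    linarith

/-- The Schur–Cohn criterion in degree two. -/
lemma norm_root_lt_one {τ γ : ℝ} (hγ1 : γ < 1) (hτ : |τ| < 1 + γ) {ρ : ℂ}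
    (h : ρ ^ 2 - τ * ρ + γ = 0) : ‖ρ‖ < 1 := by
  rw [← sq_lt_one_iff₀ (norm_nonneg _), Complex.sq_norm, Complex.normSq_apply]
  obtain ⟨hτ1, hτ2⟩ := abs_lt.mp hτ
  rcases root_cases h with ⟨_, h2⟩ | ⟨h0, h2⟩
  · linarith
  · rw [h0]
    by_contra! hc
    have : 1 ≤ |ρ.re| := by
      rw [← one_le_sq_iff_one_le_abs]; linarith
    rcases le_abs.mp this with h1 | h1
    · nlinarith
    · nlinarith

/-- The distance from a root to `γ` stays of order `1 - γ + u` or `√(γu)`, in spite of the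
cancellation in `ρ - γ` when `γ` is close to one. -/
lemma norm_root_sub_le {γ u K : ℝ} (hγ : 0 ≤ γ) (hu : 0 ≤ u) (hK : 0 ≤ K)
    (h₁ : |1 - γ - u| ≤ K) (h₂ : γ * u ≤ K ^ 2) {ρ : ℂ}
    (h : ρ ^ 2 - ((1 + γ - u : ℝ) : ℂ) * ρ + γ = 0) : ‖ρ - γ‖ ≤ K := by
  rw [← sq_le_sq₀ (norm_nonneg _) hK, Complex.sq_norm, Complex.normSq_apply]
  simp only [Complex.sub_re, Complex.ofReal_re, Complex.sub_im, Complex.ofReal_im, sub_zero]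
  rcases root_cases h with ⟨h3, h4⟩ | ⟨h0, h4⟩
  · nlinarith
  · rw [h0]
    set x := ρ.re - γ with hx
    have hx2 : x ^ 2 + γ * u = (1 - γ - u) * x := by rw [hx]; linear_combination h4
    have h5 : |x| ^ 2 ≤ K * |x| := by
      have : (1 - γ - u) * x ≤ K * |x| :=
        (le_abs_self _).trans (by rw [abs_mul]; gcongr)
      have := mul_nonneg hγ hu
      rw [sq_abs]; linarith
    have h6 : |x| ≤ K := by
      by_contra! hc
      nlinarith
    have := sq_abs x
    nlinarith [abs_nonneg x]

section bounds

variable {γ u K lam : ℝ}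

lemma abs_momentumSeq_mul_le {τ : ℝ}
    (hroot : ∀ ρ : ℂ, ρ ^ 2 - τ * ρ + γ = 0 → ‖ρ‖ ≤ lam) (n : ℕ) :
    |momentumSeq τ γ n| * √|τ ^ 2 - 4 * γ| ≤ 2 * lam ^ n := by
  obtain ⟨r, s, hsum, hprod⟩ := exists_sum_prod τ γ
  have hr := hroot r (by rw [← hsum, ← hprod]; ring)
  have hs := hroot s (by rw [← hsum, ← hprod]; ring)
  rw [← norm_sub_roots hsum hprod, ← Real.norm_eq_abs, ← Complex.norm_real, ← norm_mul,
    momentumSeq_mul_sub hsum hprod]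
  calc ‖r ^ n - s ^ n‖ ≤ ‖r‖ ^ n + ‖s‖ ^ n := by
        simpa only [norm_pow] using norm_sub_le (r ^ n) (s ^ n)
    _ ≤ lam ^ n + lam ^ n := by gcongr
    _ = 2 * lam ^ n := by ring

lemma abs_momentumSeq_succ_sub_mul_le (hγ : 0 ≤ γ) (hu : 0 ≤ u) (hK : 0 ≤ K)
    (h₁ : |1 - γ - u| ≤ K) (h₂ : γ * u ≤ K ^ 2)
    (hroot : ∀ ρ : ℂ, ρ ^ 2 - ((1 + γ - u : ℝ) : ℂ) * ρ + γ = 0 → ‖ρ‖ ≤ lam) (n : ℕ) :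
    |momentumSeq (1 + γ - u) γ (n + 1) - γ * momentumSeq (1 + γ - u) γ n| *
      √|(1 + γ - u) ^ 2 - 4 * γ| ≤ 2 * K * lam ^ n := by
  obtain ⟨r, s, hsum, hprod⟩ := exists_sum_prod (1 + γ - u) γ
  have hr' : r ^ 2 - ((1 + γ - u : ℝ) : ℂ) * r + γ = 0 := by rw [← hsum, ← hprod]; ring
  have hs' : s ^ 2 - ((1 + γ - u : ℝ) : ℂ) * s + γ = 0 := by rw [← hsum, ← hprod]; ring
  have hr := hroot r hr'
  have hs := hroot s hs'
  have hrK := norm_root_sub_le hγ hu hK h₁ h₂ hr'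
  have hsK := norm_root_sub_le hγ hu hK h₁ h₂ hs'
  rw [← norm_sub_roots hsum hprod, ← Real.norm_eq_abs, ← Complex.norm_real, ← norm_mul]
  have : ((momentumSeq (1 + γ - u) γ (n + 1) - γ * momentumSeq (1 + γ - u) γ n : ℝ) : ℂ) *
      (r - s) = r ^ n * (r - γ) - s ^ n * (s - γ) := by
    have e₁ := momentumSeq_mul_sub hsum hprod n
    have e₂ := momentumSeq_mul_sub hsum hprod (n + 1)
    push_cast at e₁ e₂ ⊢
    linear_combination e₂ - γ * e₁
  rw [this]
  have hlam : 0 ≤ lam := (norm_nonneg _).trans hr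
  calc ‖r ^ n * (r - γ) - s ^ n * (s - γ)‖ ≤ ‖r‖ ^ n * ‖r - γ‖ + ‖s‖ ^ n * ‖s - γ‖ := by
        simpa only [norm_pow, norm_mul] using norm_sub_le (r ^ n * (r - γ)) (s ^ n * (s - γ))
    _ ≤ lam ^ n * K + lam ^ n * K := by gcongr
    _ = 2 * K * lam ^ n := by ring

end bounds

lemma le_sq_of_root_bound {τ γ lam : ℝ}
    (hroot : ∀ ρ : ℂ, ρ ^ 2 - τ * ρ + γ = 0 → ‖ρ‖ ≤ lam) : γ ≤ lam ^ 2 := by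
  obtain ⟨r, s, hsum, hprod⟩ := exists_sum_prod τ γ
  have hr := hroot r (by rw [← hsum, ← hprod]; ring)
  have hs := hroot s (by rw [← hsum, ← hprod]; ring)
  calc γ ≤ ‖(γ : ℂ)‖ := by rw [Complex.norm_real]; exact le_abs_self γ
    _ = ‖r‖ * ‖s‖ := by rw [← hprod, norm_mul]
    _ ≤ lam * lam := by
        have := (norm_nonneg r).trans hr
        gcongr
    _ = lam ^ 2 := by ring

lemma pos_of_root_bound {τ γ lam : ℝ} (hdisc : 0 < |τ ^ 2 - 4 * γ|)
    (hroot : ∀ ρ : ℂ, ρ ^ 2 - τ * ρ + γ = 0 → ‖ρ‖ ≤ lam) : 0 < lam := by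
  obtain ⟨r, s, hsum, hprod⟩ := exists_sum_prod τ γ
  have hr := hroot r (by rw [← hsum, ← hprod]; ring)
  have hs := hroot s (by rw [← hsum, ← hprod]; ring)
  have h : 0 < ‖r - s‖ := by rw [norm_sub_roots hsum hprod]; exact Real.sqrt_pos.mpr hdisc
  have := norm_sub_le r s
  linarith

/-- The discount factor `γ ≤ √γ λ` makes the discounted sums a geometric series of ratio `√γ`. -/
lemma abs_discountedSeq_le {τ γ lam C : ℝ} (hγ : 0 ≤ γ) (hγ1 : γ < 1) (hlam : 0 ≤ lam)
    (hγlam : γ ≤ lam ^ 2) (hC : 0 ≤ C) (hp : ∀ n, |momentumSeq τ γ n| ≤ C * lam ^ n) (n : ℕ) :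
    (1 - γ) * |discountedSeq τ γ n| ≤ 2 * C * lam ^ n := by
  have hs1 : √γ < 1 := by rw [Real.sqrt_lt' one_pos]; linarith
  have hsl : √γ ≤ lam := by rw [Real.sqrt_le_left hlam]; exact hγlam
  have hs0 := Real.sqrt_nonneg γ
  have hsq := Real.mul_self_sqrt hγ
  have key : (1 - √γ) * |discountedSeq τ γ n| ≤ C * lam ^ n := by
    induction n with
    | zero => simpa [discountedSeq] using hC
    | succ n ih =>
      calc (1 - √γ) * |discountedSeq τ γ (n + 1)|
          ≤ (1 - √γ) * (γ * |discountedSeq τ γ n| + C * lam ^ (n + 1)) := by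
            have h1 : 0 ≤ 1 - √γ := by linarith
            gcongr
            refine (abs_add_le _ _).trans ?_
            rw [abs_mul, abs_of_nonneg hγ]
            gcongr
            exact hp _
        _ = γ * ((1 - √γ) * |discountedSeq τ γ n|) + (1 - √γ) * (C * lam ^ (n + 1)) := by ring
        _ ≤ (√γ * lam) * (C * lam ^ n) + (1 - √γ) * (C * lam ^ (n + 1)) := by
            gcongr
            nlinarith
        _ = C * lam ^ (n + 1) := by ring
  calc (1 - γ) * |discountedSeq τ γ n|
      = (1 + √γ) * ((1 - √γ) * |discountedSeq τ γ n|) := by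
        linear_combination (-|discountedSeq τ γ n|) * (-hsq)
    _ ≤ 2 * (C * lam ^ n) := by
        have : 0 ≤ C * lam ^ n := by positivity
        gcongr
        linarith
    _ = _ := by ring

/-- The bounds on the linearized dynamics in the direction of an eigenvalue `κ`: up to the factor
`M`, the responses of the position and of the averaged gradient to the initial displacement and
to an impulse all decay like `λⁿ`. -/
lemma response_bounds {γ α κ L lam Δ M : ℝ} (hγ : 0 ≤ γ) (hγ1 : γ < 1) (hα : 0 < α)
    (hκ : 0 < κ) (hκL : κ ≤ L) (hΔ : 0 < Δ)
    (hΔκ : Δ ≤ |(1 + γ - α * (1 - γ) * κ) ^ 2 - 4 * γ|)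
    (hlam1 : lam ≤ 1)
    (hroot : ∀ ρ : ℂ, ρ ^ 2 - ((1 + γ - α * (1 - γ) * κ : ℝ) : ℂ) * ρ + γ = 0 → ‖ρ‖ ≤ lam)
    (hM : M = 4 / √Δ * (2 * (1 - γ) * (1 + α * L + L) + 3 * α * γ)) (n : ℕ) :
    |momentumSeq (1 + γ - α * (1 - γ) * κ) γ (n + 1) -
      γ * momentumSeq (1 + γ - α * (1 - γ) * κ) γ n| ≤ M / 4 * lam ^ n ∧
    |(1 - γ) * κ * momentumSeq (1 + γ - α * (1 - γ) * κ) γ n| ≤ M / 4 * lam ^ n ∧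
    |(1 - γ) * momentumSeq (1 + γ - α * (1 - γ) * κ) γ (n + 1)| ≤ M / 2 * lam ^ n ∧
    |(1 - γ) ^ 2 * κ * discountedSeq (1 + γ - α * (1 - γ) * κ) γ n| ≤ M / 2 * lam ^ n := by
  have hlam := pos_of_root_bound (hΔ.trans_le hΔκ) hroot
  have hγlam := le_sq_of_root_bound hroot
  set τ := 1 + γ - α * (1 - γ) * κ with hτ
  set K := (1 - γ) * (1 + α * L + L) + α * γ with hK
  have hg : 0 < 1 - γ := by linarith
  have hL : 0 < L := hκ.trans_le hκL
  have hK0 : 0 ≤ K := by positivity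
  have hsΔ : 0 < √Δ := Real.sqrt_pos.mpr hΔ
  have hsq : √Δ ≤ √|τ ^ 2 - 4 * γ| := Real.sqrt_le_sqrt hΔκ
  have hu : 0 ≤ α * (1 - γ) * κ := by positivity
  have huL : α * (1 - γ) * κ ≤ α * (1 - γ) * L := by gcongr
  have hMK : 8 / √Δ * K ≤ M := by
    rw [hM, hK]
    have : 0 ≤ 1 / √Δ * (α * γ) := by positivity
    calc 8 / √Δ * ((1 - γ) * (1 + α * L + L) + α * γ)
        = 4 / √Δ * (2 * (1 - γ) * (1 + α * L + L) + 3 * α * γ) - 4 * (1 / √Δ * (α * γ)) := by ring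
      _ ≤ _ := by linarith
  have hp : ∀ n, |momentumSeq τ γ n| ≤ 2 / √Δ * lam ^ n := by
    intro n
    rw [div_mul_eq_mul_div, le_div_iff₀ hsΔ]
    exact le_trans (by gcongr) (abs_momentumSeq_mul_le hroot n)
  have hln : 0 ≤ lam ^ n := by positivity
  have hκK : (1 - γ) * κ ≤ K := by
    have : (1 - γ) * κ ≤ (1 - γ) * L := by gcongr
    have h1 : 0 ≤ (1 - γ) * (1 + α * L) + α * γ := by positivity
    rw [hK]; nlinarith
  have hgK : (1 - γ) ≤ K := by
    have h1 : 0 ≤ (1 - γ) * (α * L + L) + α * γ := by positivity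
    rw [hK]; nlinarith
  have hKM : K * (2 / √Δ) ≤ M / 4 := by
    calc K * (2 / √Δ) = (8 / √Δ * K) / 4 := by ring
      _ ≤ M / 4 := by gcongr
  refine ⟨?_, ?_, ?_, ?_⟩
  · have h1 : |1 - γ - α * (1 - γ) * κ| ≤ K := by
      have h2 : 0 ≤ (1 - γ) * L + α * γ := by positivity
      have h3 : 0 ≤ (1 - γ) * (α * L) := by positivity
      rw [abs_le, hK]
      constructor <;> linarith
    have h2 : γ * (α * (1 - γ) * κ) ≤ K ^ 2 := by
      -- the arithmetic-geometric mean inequality for `αγ` and `(1 - γ)κ`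
      have h3 : α * γ + (1 - γ) * κ ≤ K := by
        have : (1 - γ) * κ ≤ (1 - γ) * L := by gcongr
        have h1 : 0 ≤ (1 - γ) * (1 + α * L) := by positivity
        rw [hK]; nlinarith
      have h4 : 0 ≤ α * γ := by positivity
      have h5 : 0 ≤ (1 - γ) * κ := by positivity
      nlinarith
    have h3 := abs_momentumSeq_succ_sub_mul_le hγ hu hK0 h1 h2 hroot n
    have h4 : |momentumSeq τ γ (n + 1) - γ * momentumSeq τ γ n| ≤ 2 * K * lam ^ n / √Δ := by
      rw [le_div_iff₀ hsΔ]
      exact le_trans (by gcongr) h3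
    refine h4.trans ?_
    calc 2 * K * lam ^ n / √Δ = K * (2 / √Δ) * lam ^ n := by ring
      _ ≤ _ := by gcongr
  · rw [abs_mul, abs_of_pos (by positivity)]
    calc (1 - γ) * κ * |momentumSeq τ γ n| ≤ K * (2 / √Δ * lam ^ n) := by
          gcongr
          exact hp n
      _ = K * (2 / √Δ) * lam ^ n := by ring
      _ ≤ _ := by gcongr
  · rw [abs_mul, abs_of_pos hg]
    calc (1 - γ) * |momentumSeq τ γ (n + 1)| ≤ K * (2 / √Δ * lam ^ n) := by
          have h1 : |momentumSeq τ γ (n + 1)| ≤ 2 / √Δ * lam ^ n := by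
            refine (hp (n + 1)).trans ?_
            have : lam ^ (n + 1) ≤ lam ^ n := pow_le_pow_of_le_one hlam.le hlam1 n.le_succ
            gcongr
          gcongr
      _ = K * (2 / √Δ) * lam ^ n := by ring
      _ ≤ M / 4 * lam ^ n := by gcongr
      _ ≤ _ := by
          gcongr ?_ * _
          have : 0 ≤ K * (2 / √Δ) := by positivity
          linarith
  · have h1 := abs_discountedSeq_le hγ hγ1 hlam.le hγlam (by positivity) hp n
    rw [abs_mul, abs_of_pos (by positivity)]
    calc (1 - γ) ^ 2 * κ * |discountedSeq τ γ n|
        = (1 - γ) * κ * ((1 - γ) * |discountedSeq τ γ n|) := by ring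
      _ ≤ K * (2 * (2 / √Δ) * lam ^ n) := by gcongr
      _ = 2 * (K * (2 / √Δ)) * lam ^ n := by ring
      _ ≤ 2 * (M / 4) * lam ^ n := by gcongr
      _ = _ := by ring

/-! ### Solving the perturbed linear recurrence -/

lemma sum_Icc_succ_conv {V : Type*} [AddCommMonoid V] (φ : ℕ → ℕ → V) (t : ℕ) :
    ∑ j ∈ Finset.Icc 1 (t + 1), φ (t + 1 - j) j =
      ∑ j ∈ Finset.Icc 1 t, φ (t - j + 1) j + φ 0 (t + 1) := by
  rw [Finset.sum_Icc_succ_top (by omega), Nat.sub_self]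
  congr 1
  refine Finset.sum_congr rfl fun j hj => ?_
  rw [Finset.mem_Icc] at hj
  rw [Nat.sub_add_comm hj.2]

/-- Duhamel's formula for the position. Eliminating `m` leaves the second-order recurrence
`y_{t+2} = τ y_{t+1} - γ y_t - α (1 - γ) e_{t+1}`. -/
lemma position_formula {γ α κ : ℝ} {y m e : ℕ → ℝ} (hm1 : m 1 = 0)
    (hm : ∀ t, m (t + 2) = γ * m (t + 1) + (1 - γ) * (κ * y (t + 1) + e (t + 1)))
    (hy : ∀ t, y (t + 2) = y (t + 1) - α * m (t + 2)) (t : ℕ) :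
    y (t + 1) = (momentumSeq (1 + γ - α * (1 - γ) * κ) γ (t + 1) -
        γ * momentumSeq (1 + γ - α * (1 - γ) * κ) γ t) * y 1 -
      α * ∑ j ∈ Finset.Icc 1 t,
        (1 - γ) * momentumSeq (1 + γ - α * (1 - γ) * κ) γ (t - j + 1) * e j := by
  induction t using Nat.twoStepInduction with
  | zero => simp [momentumSeq]
  | one => simp [momentumSeq, hy 0, hm 0, hm1]; ring
  | more t h₀ h₁ =>
    have e2 : y (t + 3) = (1 + γ - α * (1 - γ) * κ) * y (t + 2) - γ * y (t + 1)
        - α * (1 - γ) * e (t + 2) := by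
      linear_combination hy (t + 1) - α * hm (t + 1) - γ * hy t
    rw [show t + 2 + 1 = t + 3 from rfl, e2, h₁, h₀]
    set τ := 1 + γ - α * (1 - γ) * κ
    rw [sum_Icc_succ_conv (fun n j => (1 - γ) * momentumSeq τ γ (n + 1) * e j) (t + 1)]
    have e3 : ∑ j ∈ Finset.Icc 1 (t + 1), (1 - γ) * momentumSeq τ γ (t + 1 - j + 1 + 1) * e j =
        τ * ∑ j ∈ Finset.Icc 1 (t + 1), (1 - γ) * momentumSeq τ γ (t + 1 - j + 1) * e j -
        γ * ∑ j ∈ Finset.Icc 1 (t + 1), (1 - γ) * momentumSeq τ γ (t + 1 - j) * e j := by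
      rw [Finset.mul_sum, Finset.mul_sum, ← Finset.sum_sub_distrib]
      refine Finset.sum_congr rfl fun j _ => ?_
      simp only [momentumSeq]
      ring
    have e4 := sum_Icc_succ_conv (fun n j => (1 - γ) * momentumSeq τ γ n * e j) t
    rw [e3, e4]
    simp only [momentumSeq]
    ring

/-- Duhamel's formula for the averaged gradient `(1 - γ) ∑_{j ≤ t} γ^{t-j} κ y_j`; the response to
the initial displacement telescopes, because `p_{t+1} - γ p_t` is that of the position. -/
lemma averaged_gradient_formula {γ α κ : ℝ} {y m e : ℕ → ℝ} (hm1 : m 1 = 0)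
    (hm : ∀ t, m (t + 2) = γ * m (t + 1) + (1 - γ) * (κ * y (t + 1) + e (t + 1)))
    (hy : ∀ t, y (t + 2) = y (t + 1) - α * m (t + 2)) (t : ℕ) :
    (1 - γ) * ∑ j ∈ Finset.Icc 1 t, γ ^ (t - j) * (κ * y j) =
      (1 - γ) * κ * momentumSeq (1 + γ - α * (1 - γ) * κ) γ t * y 1 -
      α * ∑ j ∈ Finset.Icc 1 t,
        (1 - γ) ^ 2 * κ * discountedSeq (1 + γ - α * (1 - γ) * κ) γ (t - j) * e j := by
  induction t with
  | zero => simp [momentumSeq]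
  | succ t ih =>
    have hpos := position_formula hm1 hm hy t
    set τ := 1 + γ - α * (1 - γ) * κ
    rw [sum_Icc_succ_conv (fun n j => γ ^ n * (κ * y j)) t,
      sum_Icc_succ_conv (fun n j => (1 - γ) ^ 2 * κ * discountedSeq τ γ n * e j) t]
    have e1 : ∑ j ∈ Finset.Icc 1 t, γ ^ (t - j + 1) * (κ * y j) =
        γ * ∑ j ∈ Finset.Icc 1 t, γ ^ (t - j) * (κ * y j) := by
      rw [Finset.mul_sum]
      exact Finset.sum_congr rfl fun j _ => by ring
    have e2 : ∑ j ∈ Finset.Icc 1 t, (1 - γ) ^ 2 * κ * discountedSeq τ γ (t - j + 1) * e j =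
        γ * ∑ j ∈ Finset.Icc 1 t, (1 - γ) ^ 2 * κ * discountedSeq τ γ (t - j) * e j +
        (1 - γ) * κ * ∑ j ∈ Finset.Icc 1 t, (1 - γ) * momentumSeq τ γ (t - j + 1) * e j := by
      rw [Finset.mul_sum, Finset.mul_sum, ← Finset.sum_add_distrib]
      refine Finset.sum_congr rfl fun j _ => ?_
      simp only [discountedSeq]
      ring
    rw [e1, e2, hpos]
    simp only [discountedSeq]
    linear_combination γ * ih

/-! ### The spectral radius of the momentum matrix -/

open Matrix in
lemma mem_spectrum_iff_exists_mulVec {n : Type*} [Fintype n] [DecidableEq n]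
    (G : Matrix n n ℂ) (ρ : ℂ) : ρ ∈ spectrum ℂ G ↔ ∃ v ≠ 0, G *ᵥ v = ρ • v := by
  rw [spectrum.mem_iff, Matrix.isUnit_iff_isUnit_det, isUnit_iff_ne_zero, not_not,
    ← Matrix.exists_mulVec_eq_zero_iff]
  refine exists_congr fun v => and_congr_right fun _ => ?_
  rw [Matrix.sub_mulVec, sub_eq_zero, Algebra.algebraMap_eq_smul_one, Matrix.smul_mulVec,
    Matrix.one_mulVec, eq_comm]

lemma finite_spectrum_complex {n : Type*} [Fintype n] [DecidableEq n] (G : Matrix n n ℂ) :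
    (spectrum ℂ G).Finite := by
  rw [← Matrix.spectrum_toLin']
  exact Module.End.finite_spectrum _

lemma norm_le_toReal_spectralRadius {n : Type*} [Fintype n] [DecidableEq n] (G : Matrix n n ℂ)
    {ρ : ℂ} (hρ : ρ ∈ spectrum ℂ G) : ‖ρ‖ ≤ (spectralRadius ℂ G).toReal := by
  -- finiteness excludes the junk value of `toReal` at `⊤`
  have hfin : spectralRadius ℂ G ≠ ⊤ := by
    have h := (finite_spectrum_complex G)
    obtain ⟨C, hC⟩ := (h.image (fun ρ : ℂ => ‖ρ‖₊)).bddAbove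
    refine ne_top_of_le_ne_top (ENNReal.coe_ne_top (r := C)) ?_
    refine iSup₂_le fun ρ hρ => ?_
    exact ENNReal.coe_le_coe.mpr (hC ⟨ρ, hρ, rfl⟩)
  have h : (‖ρ‖₊ : ℝ≥0∞) ≤ spectralRadius ℂ G := le_iSup₂ (f := fun k _ => (‖k‖₊ : ℝ≥0∞)) ρ hρ
  simpa using (ENNReal.toReal_le_toReal ENNReal.coe_ne_top hfin).mpr h

lemma toReal_spectralRadius_lt_one {n : Type*} [Fintype n] [DecidableEq n] (G : Matrix n n ℂ)
    (h : ∀ ρ ∈ spectrum ℂ G, ‖ρ‖ < 1) : (spectralRadius ℂ G).toReal < 1 := by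
  have hlt : spectralRadius ℂ G < 1 := by
    have : spectralRadius ℂ G = ⨆ ρ ∈ (finite_spectrum_complex G).toFinset, (‖ρ‖₊ : ℝ≥0∞) := by
      simp [spectralRadius]
    rw [this, ← Finset.sup_eq_iSup, Finset.sup_lt_iff (by simp)]
    intro ρ hρ
    rw [Set.Finite.mem_toFinset] at hρ
    have h1 : ‖ρ‖₊ < 1 := h ρ hρ
    exact_mod_cast h1
  simpa using (ENNReal.toReal_lt_toReal hlt.ne_top ENNReal.one_ne_top).mpr hlt

lemma ext_inner_orthonormalBasis {ι V : Type*} [Fintype ι] [NormedAddCommGroup V]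
    [InnerProductSpace ℝ V] (b : OrthonormalBasis ι ℝ V) {v w : V}
    (h : ∀ k, inner ℝ (b k) v = inner ℝ (b k) w) : v = w := by
  refine b.repr.injective ?_
  ext k
  simpa [b.repr_apply_apply] using h k

section momentumMatrix

open Matrix

variable {d : ℕ} {A : Matrix (Fin d) (Fin d) ℝ} (hA : A.IsHermitian) {α γ : ℝ}

lemma Gam_map_mulVec (A : Matrix (Fin d) (Fin d) ℝ) (α γ : ℝ) (a c : Fin d → ℂ) :
    (SGDM.Gam A α γ).map (algebraMap ℝ ℂ) *ᵥ Sum.elim a c =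
      Sum.elim ((γ : ℂ) • a + (1 - γ : ℂ) • (A.map (algebraMap ℝ ℂ) *ᵥ c))
        (-(α * γ : ℂ) • a + (c - (α * (1 - γ) : ℂ) • (A.map (algebraMap ℝ ℂ) *ᵥ c))) := by
  have e : (SGDM.Gam A α γ).map (algebraMap ℝ ℂ) =
      Matrix.fromBlocks ((γ : ℂ) • 1) ((1 - γ : ℂ) • A.map (algebraMap ℝ ℂ))
        (-(α * γ : ℂ) • 1) (1 - (α * (1 - γ) : ℂ) • A.map (algebraMap ℝ ℂ)) := by
    rw [SGDM.Gam, Matrix.fromBlocks_map]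
    congr 1 <;> ext i j <;> by_cases h : i = j <;> simp [h]
  rw [e, Matrix.fromBlocks_mulVec]
  simp only [Sum.elim_comp_inl, Sum.elim_comp_inr, Matrix.sub_mulVec, Matrix.smul_mulVec,
    Matrix.one_mulVec]

/-- The complexification of an eigenvector of a real symmetric matrix. -/
noncomputable def complexEigenvector (k : Fin d) : Fin d → ℂ := fun i => (hA.eigenvectorBasis k i : ℂ)

lemma map_mulVec_complexEigenvector (k : Fin d) :
    A.map (algebraMap ℝ ℂ) *ᵥ complexEigenvector hA k =
      (hA.eigenvalues k : ℂ) • complexEigenvector hA k := by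
  have h := hA.mulVec_eigenvectorBasis k
  ext i
  have hi := congrArg (fun r : ℝ => (r : ℂ)) (congrFun h i)
  simp only [Matrix.mulVec, dotProduct, Complex.ofReal_sum, Complex.ofReal_mul, Pi.smul_apply,
    smul_eq_mul] at hi
  simpa [Matrix.mulVec, dotProduct, complexEigenvector] using hi

lemma complexEigenvector_ne_zero (k : Fin d) : complexEigenvector hA k ≠ 0 := by
  intro h
  have : hA.eigenvectorBasis k = 0 := by
    ext i
    simpa [complexEigenvector] using congrFun h i
  exact (hA.eigenvectorBasis.orthonormal.ne_zero k) this

lemma complexEigenvector_dotProduct_map_mulVec (k : Fin d) (c : Fin d → ℂ) :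
    complexEigenvector hA k ⬝ᵥ (A.map (algebraMap ℝ ℂ) *ᵥ c) =
      hA.eigenvalues k * (complexEigenvector hA k ⬝ᵥ c) := by
  have hsymm : (A.map (algebraMap ℝ ℂ))ᵀ = A.map (algebraMap ℝ ℂ) := by
    rw [← Matrix.transpose_map]
    congr 1
  rw [Matrix.dotProduct_mulVec, ← Matrix.mulVec_transpose, hsymm,
    map_mulVec_complexEigenvector, smul_dotProduct, smul_eq_mul]

lemma exists_complexEigenvector_dotProduct_ne_zero {c : Fin d → ℂ} (hc : c ≠ 0) :
    ∃ k, complexEigenvector hA k ⬝ᵥ c ≠ 0 := by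
  by_contra! h
  apply hc
  have key : ∀ w : EuclideanSpace ℝ (Fin d), (∀ k, ∑ i, hA.eigenvectorBasis k i * w i = 0) →
      w = 0 := by
    intro w hw
    refine ext_inner_orthonormalBasis hA.eigenvectorBasis fun k => ?_
    simpa [PiLp.inner_apply, mul_comm] using hw k
  have hre := key (WithLp.toLp 2 fun i => (c i).re) fun k => by
    simpa [complexEigenvector, dotProduct] using congrArg Complex.re (h k)
  have him := key (WithLp.toLp 2 fun i => (c i).im) fun k => by
    simpa [complexEigenvector, dotProduct] using congrArg Complex.im (h k)
  ext i
  apply Complex.ext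
  · simpa using congrFun (congrArg WithLp.ofLp hre) i
  · simpa using congrFun (congrArg WithLp.ofLp him) i

/-- Every root of the characteristic polynomial of the `2 × 2` block belonging to an eigenvalue of
`A` is an eigenvalue of `Γ`. -/
lemma root_norm_le_rate (hγ1 : γ < 1) (k : Fin d) (hκ : 0 < hA.eigenvalues k) {ρ : ℂ}
    (h : ρ ^ 2 - ((1 + γ - α * (1 - γ) * hA.eigenvalues k : ℝ) : ℂ) * ρ + γ = 0) :
    ‖ρ‖ ≤ SGDM.rate A α γ := by
  refine norm_le_toReal_spectralRadius _ ?_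
  rw [mem_spectrum_iff_exists_mulVec]
  set b := complexEigenvector hA k with hb
  set κ := hA.eigenvalues k with hk
  -- the eigenvector `((1 - γ) κ b, (ρ - γ) b)` is nonzero since `(1 - γ) κ > 0`
  refine ⟨Sum.elim (((1 - γ) * κ : ℂ) • b) ((ρ - γ) • b), ?_, ?_⟩
  · intro h0
    have h1 : ((1 - γ) * κ : ℂ) • b = 0 := by
      ext i
      simpa using congrFun h0 (Sum.inl i)
    rcases smul_eq_zero.mp h1 with h2 | h2
    · have h3 : (1 - γ) * κ = 0 := by exact_mod_cast h2
      have : 0 < (1 - γ) * κ := mul_pos (by linarith) hκ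
      exact this.ne' h3
    · exact complexEigenvector_ne_zero hA k h2
  · rw [Gam_map_mulVec, Matrix.mulVec_smul, map_mulVec_complexEigenvector, ← hb, ← hk]
    push_cast at h
    ext i
    rcases i with i | i
    · simp
      ring
    · simp
      linear_combination -(b i) * h

/-- Projecting onto the eigenvectors of `A` reduces the eigenvalue equation of `Γ` to the
`2 × 2` blocks. -/
lemma rate_lt_one (hγ1 : γ < 1) (hα : 0 < α)
    (hκ : ∀ k, 0 < hA.eigenvalues k)
    (hκ' : ∀ k, α * hA.eigenvalues k < 2 * (1 + γ) / (1 - γ)) :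
    SGDM.rate A α γ < 1 := by
  refine toReal_spectralRadius_lt_one _ fun ρ hρ => ?_
  obtain ⟨v, hv0, hv⟩ := (mem_spectrum_iff_exists_mulVec _ _).mp hρ
  obtain ⟨a, c, rfl⟩ : ∃ a c, v = Sum.elim a c :=
    ⟨v ∘ Sum.inl, v ∘ Sum.inr, (Sum.elim_comp_inl_inr v).symm⟩
  rw [Gam_map_mulVec] at hv
  have h1 : (γ : ℂ) • a + (1 - γ : ℂ) • (A.map (algebraMap ℝ ℂ) *ᵥ c) = ρ • a := by
    ext i
    simpa using congrFun hv (Sum.inl i)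
  have h2 : -(α * γ : ℂ) • a + (c - (α * (1 - γ) : ℂ) • (A.map (algebraMap ℝ ℂ) *ᵥ c)) =
      ρ • c := by
    ext i
    simpa using congrFun hv (Sum.inr i)
  have key : ∃ k, complexEigenvector hA k ⬝ᵥ a ≠ 0 ∨ complexEigenvector hA k ⬝ᵥ c ≠ 0 := by
    by_cases ha : a = 0
    · have hc : c ≠ 0 := by
        rintro rfl
        apply hv0
        rw [ha]
        ext i
        rcases i with i | i <;> rfl
      obtain ⟨k, hk⟩ := exists_complexEigenvector_dotProduct_ne_zero hA hc
      exact ⟨k, Or.inr hk⟩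
    · obtain ⟨k, hk⟩ := exists_complexEigenvector_dotProduct_ne_zero hA ha
      exact ⟨k, Or.inl hk⟩
  obtain ⟨k, hk⟩ := key
  have e1 := congrArg (complexEigenvector hA k ⬝ᵥ ·) h1
  have e2 := congrArg (complexEigenvector hA k ⬝ᵥ ·) h2
  simp only [dotProduct_add, dotProduct_sub, dotProduct_smul, smul_eq_mul,
    complexEigenvector_dotProduct_map_mulVec] at e1 e2
  set a' := complexEigenvector hA k ⬝ᵥ a
  set c' := complexEigenvector hA k ⬝ᵥ c
  have hκk := hκ k
  have hκk' := hκ' k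
  set κ := hA.eigenvalues k
  have hroot : ρ ^ 2 - ((1 + γ - α * (1 - γ) * κ : ℝ) : ℂ) * ρ + γ = 0 := by
    push_cast
    -- the adjugate of the `2 × 2` block annihilates a nonzero vector
    rcases hk with h0 | h0
    · refine (mul_eq_zero.mp (?_ : _ * a' = 0)).resolve_right h0
      linear_combination (1 - α * (1 - γ) * κ - ρ) * e1 - (1 - γ) * κ * e2
    · refine (mul_eq_zero.mp (?_ : _ * c' = 0)).resolve_right h0
      linear_combination (α * γ) * e1 + (γ - ρ) * e2
  have hg : 0 < 1 - γ := by linarith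
  refine norm_root_lt_one hγ1 ?_ hroot
  rw [lt_div_iff₀ hg] at hκk'
  have : 0 < α * (1 - γ) * κ := by positivity
  rw [abs_lt]
  constructor <;> linarith

lemma gap_le (k : Fin d) :
    SGDM.gap A α γ ≤ |(1 + γ - α * (1 - γ) * hA.eigenvalues k) ^ 2 - 4 * γ| := by
  have hmem : hA.eigenvalues k ∈ spectrum ℝ A :=
    hA.spectrum_real_eq_range_eigenvalues ▸ Set.mem_range_self k
  have : SGDM.gap A α γ ≤ |(γ + 1 - α * (1 - γ) * hA.eigenvalues k) ^ 2 - 4 * γ| :=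
    csInf_le (A.finite_real_spectrum.image
      (fun κ : ℝ => |(γ + 1 - α * (1 - γ) * κ) ^ 2 - 4 * γ|)).bddBelow
      (Set.mem_image_of_mem _ hmem)
  rwa [add_comm γ 1] at this

lemma rate_pos (hγ1 : γ < 1) (hκ : ∀ k, 0 < hA.eigenvalues k)
    (hgap : 0 < SGDM.gap A α γ) (hd : 0 < d) : 0 < SGDM.rate A α γ :=
  pos_of_root_bound (hgap.trans_le (gap_le hA ⟨0, hd⟩)) fun _ h =>
    root_norm_le_rate hA hγ1 ⟨0, hd⟩ (hκ _) h

end momentumMatrix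

/-! ### Operators that are diagonal in an orthonormal basis -/

section diagonal

variable {d : ℕ} (b : OrthonormalBasis (Fin d) ℝ (SGDM.E d))

/-- The operator with eigenvectors `b k` and eigenvalues `c k`. -/
noncomputable def diagOp (c : Fin d → ℝ) : SGDM.E d →L[ℝ] SGDM.E d :=
  ∑ k, c k • (innerSL ℝ (b k)).smulRight (b k)

lemma inner_diagOp (c : Fin d → ℝ) (v : SGDM.E d) (k : Fin d) :
    inner ℝ (b k) (diagOp b c v) = c k * inner ℝ (b k) v := by
  have h := orthonormal_iff_ite.mp b.orthonormal
  simp [diagOp, inner_sum, inner_smul_right, h]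

lemma norm_diagOp_le {c : Fin d → ℝ} {C : ℝ} (hC : 0 ≤ C) (hc : ∀ k, |c k| ≤ C) :
    ‖diagOp b c‖ ≤ C := by
  refine ContinuousLinearMap.opNorm_le_bound _ hC fun v => ?_
  rw [← sq_le_sq₀ (norm_nonneg _) (by positivity), ← b.sum_sq_norm_inner_right, mul_pow,
    ← b.sum_sq_norm_inner_right v, Finset.mul_sum]
  refine Finset.sum_le_sum fun k _ => ?_
  rw [inner_diagOp, norm_mul, mul_pow]
  gcongr
  exact hc k

end diagonal

/-! ### The linearized dynamics -/

open Matrix in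
lemma inner_op_apply {d : ℕ} {A : Matrix (Fin d) (Fin d) ℝ} (hA : A.IsHermitian) (k : Fin d)
    (v : SGDM.E d) : inner ℝ (hA.eigenvectorBasis k) (SGDM.op A v) =
      hA.eigenvalues k * inner ℝ (hA.eigenvectorBasis k) v := by
  have h := hA.mulVec_eigenvectorBasis k
  have hs : (Matrix.toEuclideanLin A).IsSymmetric :=
    Matrix.isSymmetric_toEuclideanLin_iff.mpr hA
  have h2 : SGDM.op A (hA.eigenvectorBasis k) =
      hA.eigenvalues k • hA.eigenvectorBasis k := by
    ext i
    simpa using congrFun h i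
  calc inner ℝ (hA.eigenvectorBasis k) (SGDM.op A v)
      = inner ℝ (SGDM.op A (hA.eigenvectorBasis k)) v := (hs (hA.eigenvectorBasis k) v).symm
    _ = _ := by rw [h2, inner_smul_left]; simp

/-- The linearized momentum dynamics `m_{t+1} = γ m_t + (1 - γ)(A y_t + e_t)`,
`y_{t+1} = y_t - α m_{t+1}`, solved by Duhamel's formula: `y_{t+1}` and the averaged gradient
differ from the response to the impulses `e_j` by at most `(M / 4) λᵗ ‖y_1‖`, and the impulse
responses have norm at most `(M / 2) λⁿ`. -/
theorem exists_impulse_response {d : ℕ} {A : Matrix (Fin d) (Fin d) ℝ} (hA : A.IsHermitian)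
    {α γ : ℝ} (hγ : 0 ≤ γ) (hγ1 : γ < 1) (hα : 0 < α)
    (hκ : ∀ k, 0 < hA.eigenvalues k) (hlam : SGDM.rate A α γ < 1)
    (hgap : 0 < SGDM.gap A α γ) (hlam0 : 0 ≤ SGDM.rate A α γ) (hM0 : 0 ≤ SGDM.bigM A α γ) :
    ∃ W₁ W₂ : ℕ → SGDM.E d →L[ℝ] SGDM.E d,
      (∀ n, ‖W₁ n‖ ≤ SGDM.bigM A α γ / 2 * SGDM.rate A α γ ^ n) ∧
      (∀ n, ‖W₂ n‖ ≤ SGDM.bigM A α γ / 2 * SGDM.rate A α γ ^ n) ∧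
      ∀ y m e : ℕ → SGDM.E d, m 1 = 0 →
        (∀ t, m (t + 2) = γ • m (t + 1) + (1 - γ) • (SGDM.op A (y (t + 1)) + e (t + 1))) →
        (∀ t, y (t + 2) = y (t + 1) - α • m (t + 2)) → ∀ t,
        ‖(1 - γ) • ∑ j ∈ Finset.Icc 1 t, γ ^ (t - j) • SGDM.op A (y j) +
            α • ∑ j ∈ Finset.Icc 1 t, W₁ (t - j) (e j)‖ ≤
          SGDM.bigM A α γ / 4 * SGDM.rate A α γ ^ t * ‖y 1‖ ∧
        ‖y (t + 1) + α • ∑ j ∈ Finset.Icc 1 t, W₂ (t - j) (e j)‖ ≤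
          SGDM.bigM A α γ / 4 * SGDM.rate A α γ ^ t * ‖y 1‖ := by
  have hspec := hA.spectrum_real_eq_range_eigenvalues
  have hfin : (spectrum ℝ A).Finite := A.finite_real_spectrum
  have hmem : ∀ k, hA.eigenvalues k ∈ spectrum ℝ A := fun k => hspec ▸ Set.mem_range_self k
  have hb : ∀ k n, _ := fun k n => response_bounds (lam := SGDM.rate A α γ) hγ hγ1 hα (hκ k)
    (le_csSup hfin.bddAbove (hmem k)) hgap
    (gap_le hA k) hlam.le
    (fun ρ h => root_norm_le_rate hA hγ1 k (hκ k) h) (M := SGDM.bigM A α γ) rfl n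
  set τ : Fin d → ℝ := fun k => 1 + γ - α * (1 - γ) * hA.eigenvalues k with hτ
  set b := hA.eigenvectorBasis
  set lam := SGDM.rate A α γ
  set M := SGDM.bigM A α γ
  refine ⟨fun n => diagOp b fun k => (1 - γ) ^ 2 * hA.eigenvalues k * discountedSeq (τ k) γ n,
    fun n => diagOp b fun k => (1 - γ) * momentumSeq (τ k) γ (n + 1), fun n => ?_, fun n => ?_, ?_⟩
  · exact norm_diagOp_le b (by positivity) fun k => (hb k n).2.2.2
  · exact norm_diagOp_le b (by positivity) fun k => (hb k n).2.2.1
  intro y m e hm1 hm hy t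
  -- the recurrences of the coordinates in the eigenbasis
  have hm1' : ∀ k, inner ℝ (b k) (m 1) = 0 := fun k => by rw [hm1, inner_zero_right]
  have hm' : ∀ k t, inner ℝ (b k) (m (t + 2)) = γ * inner ℝ (b k) (m (t + 1)) +
      (1 - γ) * (hA.eigenvalues k * inner ℝ (b k) (y (t + 1)) + inner ℝ (b k) (e (t + 1))) := by
    intro k t
    rw [hm, inner_add_right, inner_smul_right, inner_smul_right, inner_add_right,
      inner_op_apply]
  have hy' : ∀ k t, inner ℝ (b k) (y (t + 2)) = inner ℝ (b k) (y (t + 1)) -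
      α * inner ℝ (b k) (m (t + 2)) := by
    intro k t
    rw [hy, inner_sub_right, inner_smul_right]
  constructor
  · have : (1 - γ) • ∑ j ∈ Finset.Icc 1 t, γ ^ (t - j) • SGDM.op A (y j) +
        α • ∑ j ∈ Finset.Icc 1 t, (diagOp b fun k => (1 - γ) ^ 2 * hA.eigenvalues k *
          discountedSeq (τ k) γ (t - j)) (e j) =
        (diagOp b fun k => (1 - γ) * hA.eigenvalues k * momentumSeq (τ k) γ t) (y 1) := by
      refine ext_inner_orthonormalBasis b fun k => ?_
      have := averaged_gradient_formula (y := fun t => inner ℝ (b k) (y t))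
        (m := fun t => inner ℝ (b k) (m t)) (e := fun t => inner ℝ (b k) (e t)) (hm1' k) (hm' k) (hy' k) t
      simp only [inner_add_right, inner_smul_right, inner_sum,
        inner_diagOp, inner_op_apply, b]
      linear_combination this
    rw [this]
    exact ContinuousLinearMap.le_of_opNorm_le _
      (norm_diagOp_le b (by positivity) fun k => (hb k t).2.1) _
  · have : y (t + 1) + α • ∑ j ∈ Finset.Icc 1 t,
        (diagOp b fun k => (1 - γ) * momentumSeq (τ k) γ (t - j + 1)) (e j) =
        (diagOp b fun k => momentumSeq (τ k) γ (t + 1) - γ * momentumSeq (τ k) γ t) (y 1) := by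
      refine ext_inner_orthonormalBasis b fun k => ?_
      have := position_formula (y := fun t => inner ℝ (b k) (y t))
        (m := fun t => inner ℝ (b k) (m t)) (e := fun t => inner ℝ (b k) (e t)) (hm1' k) (hm' k) (hy' k) t
      simp only [inner_add_right, inner_smul_right, inner_sum,
        inner_diagOp]
      linear_combination this
    rw [this]
    exact ContinuousLinearMap.le_of_opNorm_le _
      (norm_diagOp_le b (by positivity) fun k => (hb k t).1) _

/-! ### Gradients and Hessians of the random losses -/

section calculus

variable {d : ℕ}

lemma inner_gradient_eq_fderiv (F : SGDM.E d → ℝ) (x v : SGDM.E d) :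
    inner ℝ v (gradient F x) = fderiv ℝ F x v := by
  rw [real_inner_comm, gradient, InnerProductSpace.toDual_symm_apply]

lemma hasFDerivAt_innerSL_gradient {F : SGDM.E d → ℝ} (hF : Differentiable ℝ F) (x : SGDM.E d) :
    HasFDerivAt F (innerSL ℝ (gradient F x)) x := by
  have h : innerSL ℝ (gradient F x) = fderiv ℝ F x := by
    refine ContinuousLinearMap.ext fun v => ?_
    rw [innerSL_apply_apply, real_inner_comm, inner_gradient_eq_fderiv]
  rw [h]
  exact (hF x).hasFDerivAt

lemma op_hessian (F : SGDM.E d → ℝ) (x : SGDM.E d) :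
    SGDM.op (SGDM.hessian F x) = fderiv ℝ (gradient F) x := by
  ext v i
  have hv : v = ∑ j, v j • EuclideanSpace.single j (1 : ℝ) := by
    simpa using ((EuclideanSpace.basisFun (Fin d) ℝ).sum_repr v).symm
  conv_rhs => rw [hv, map_sum]
  simp [SGDM.hessian, Matrix.mulVec, dotProduct, mul_comm]

lemma isHermitian_hessian {F : SGDM.E d → ℝ} (hF : SGDM.TwiceDifferentiable F) (x : SGDM.E d) :
    (SGDM.hessian F x).IsHermitian := by
  -- the derivative of `F`, written as a linear function of its gradient
  let L : SGDM.E d →L[ℝ] SGDM.E d →L[ℝ] ℝ :=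
    ∑ i, (EuclideanSpace.proj i : SGDM.E d →L[ℝ] ℝ).smulRight
      (EuclideanSpace.proj i : SGDM.E d →L[ℝ] ℝ)
  have hL : ∀ v w, L v w = inner ℝ v w := by
    intro v w
    simp [L, PiLp.inner_apply, mul_comm]
  have h1 : ∀ y, HasFDerivAt F (L (gradient F y)) y := by
    intro y
    have h : L (gradient F y) = innerSL ℝ (gradient F y) := by
      refine ContinuousLinearMap.ext fun v => ?_
      rw [hL, innerSL_apply_apply]
    rw [h]
    exact hasFDerivAt_innerSL_gradient hF.1 y
  have h2 : HasFDerivAt (fun y => L (gradient F y)) (L.comp (fderiv ℝ (gradient F) x)) x :=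
    L.hasFDerivAt.comp x (hF.2 x).hasFDerivAt
  have h3 := second_derivative_symmetric h1 h2
  ext i j
  have := h3 (EuclideanSpace.single i 1) (EuclideanSpace.single j 1)
  simp only [ContinuousLinearMap.comp_apply, hL] at this
  simpa [SGDM.hessian, EuclideanSpace.inner_single_right] using this

/-- Mean value inequality: a Lipschitz condition on the Hessian at a critical point bounds the
second-order remainder of the gradient. -/
lemma norm_gradient_sub_hessian_le {F : SGDM.E d → ℝ} (hF : SGDM.TwiceDifferentiable F)
    {xs : SGDM.E d} {C : ℝ} (hC : 0 ≤ C) (hxs : gradient F xs = 0)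
    (hlip : ∀ x, ‖SGDM.op (SGDM.hessian F x - SGDM.hessian F xs)‖ ≤ C * ‖x - xs‖)
    (x : SGDM.E d) :
    ‖gradient F x - SGDM.op (SGDM.hessian F xs) (x - xs)‖ ≤ C * ‖x - xs‖ ^ 2 := by
  have h := Convex.norm_image_sub_le_of_norm_fderiv_le' (𝕜 := ℝ) (f := gradient F)
    (C := C * ‖x - xs‖) (s := Metric.closedBall xs ‖x - xs‖) (x := xs) (y := x)
    (φ := SGDM.op (SGDM.hessian F xs)) (fun y _ => hF.2 y) (fun y hy => ?_)
    (convex_closedBall _ _) (by simp) (by simp [dist_eq_norm])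
  · rw [hxs, sub_zero] at h
    linarith [h, sq ‖x - xs‖]
  · rw [← op_hessian, ← map_sub]
    refine (hlip y).trans ?_
    rw [Metric.mem_closedBall, dist_eq_norm] at hy
    gcongr

lemma gradient_batchLoss {B : ℕ} {S : Type*} {f : S → SGDM.E d → ℝ}
    (hf : ∀ s, Differentiable ℝ (f s)) (η : Fin B → S) (x : SGDM.E d) :
    gradient (SGDM.batchLoss f η) x = (1 / (B : ℝ)) • ∑ i, gradient (f (η i)) x := by
  have h : HasFDerivAt (SGDM.batchLoss f η)
      ((1 / (B : ℝ)) • ∑ i, fderiv ℝ (f (η i)) x) x :=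
    (HasFDerivAt.fun_sum fun i _ => (hf (η i) x).hasFDerivAt).const_mul (1 / (B : ℝ))
  refine ext_inner_left ℝ fun v => ?_
  rw [inner_gradient_eq_fderiv, h.fderiv, inner_smul_right, inner_sum]
  simp

end calculus

section measurability

variable {d : ℕ} {S : Type*} [MeasurableSpace S]

lemma measurable_of_inner {X : S → SGDM.E d}
    (h : ∀ v : SGDM.E d, Measurable fun s => inner ℝ v (X s)) : Measurable X := by
  have : X = fun s => ∑ i, inner ℝ (EuclideanSpace.basisFun (Fin d) ℝ i) (X s) •
      EuclideanSpace.basisFun (Fin d) ℝ i := by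
    ext1 s
    exact ((EuclideanSpace.basisFun (Fin d) ℝ).sum_repr' (X s)).symm
  rw [this]
  exact Finset.measurable_sum _ fun i _ => (h _).smul_const _

lemma integrable_of_inner {P : Measure S} {X : S → SGDM.E d}
    (h : ∀ v : SGDM.E d, ‖v‖ = 1 → Integrable (fun s => inner ℝ v (X s)) P) : Integrable X P := by
  have : X = fun s => ∑ i, inner ℝ (EuclideanSpace.basisFun (Fin d) ℝ i) (X s) •
      EuclideanSpace.basisFun (Fin d) ℝ i := by
    ext1 s
    exact ((EuclideanSpace.basisFun (Fin d) ℝ).sum_repr' (X s)).symm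
  rw [this]
  exact integrable_finsetSum _ fun i _ =>
    (h _ ((EuclideanSpace.basisFun (Fin d) ℝ).norm_eq_one i)).smul_const _

lemma tendsto_difference_quotient {V : Type*} [NormedAddCommGroup V] [NormedSpace ℝ V]
    {F : SGDM.E d → V} {x : SGDM.E d} (hF : DifferentiableAt ℝ F x) (v : SGDM.E d) :
    Filter.Tendsto (fun n : ℕ => (n : ℝ) • (F (x + (n : ℝ)⁻¹ • v) - F x)) Filter.atTop
      (nhds (fderiv ℝ F x v)) := by
  refine hF.hasFDerivAt.lim v ?_
  simpa using tendsto_natCast_atTop_atTop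

lemma measurable_gradient {f : S → SGDM.E d → ℝ} (hm : ∀ x, Measurable fun s => f s x)
    (hf : ∀ s, Differentiable ℝ (f s)) (x : SGDM.E d) :
    Measurable fun s => gradient (f s) x := by
  refine measurable_of_inner fun v => ?_
  simp only [inner_gradient_eq_fderiv]
  refine measurable_of_tendsto_metrizable
    (f := fun (n : ℕ) s => (n : ℝ) • (f s (x + (n : ℝ)⁻¹ • v) - f s x)) (fun n => ?_) ?_
  · exact ((hm (x + (n : ℝ)⁻¹ • v)).sub (hm x)).const_mul (n : ℝ)
  · rw [tendsto_pi_nhds]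
    exact fun s => tendsto_difference_quotient (hf s x) v

end measurability

/-! ### Consequences of exponential moments -/

section expMoment

variable {S : Type*} [MeasurableSpace S] {P : Measure S}

lemma integrable_of_lintegral_exp_le {X : S → ℝ} (hX : AEStronglyMeasurable X P) {K : ℝ}
    (hK : 0 < K) {C : ℝ≥0∞} (hC : C ≠ ⊤)
    (h : ∫⁻ s, ENNReal.ofReal (Real.exp (|X s| / K)) ∂P ≤ C) : Integrable X P := by
  have h1 : Integrable (fun s => X s / K) P := by
    refine ⟨by simpa only [div_eq_mul_inv] using hX.mul_const K⁻¹, ?_⟩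
    rw [hasFiniteIntegral_iff_norm]
    refine lt_of_le_of_lt (lintegral_mono fun s => ?_) (h.trans_lt hC.lt_top)
    apply ENNReal.ofReal_le_ofReal
    rw [Real.norm_eq_abs, abs_div, abs_of_pos hK]
    linarith [Real.add_one_le_exp (|X s| / K)]
  simpa [div_mul_cancel₀ _ hK.ne'] using h1.mul_const K

/-- The bound follows from `E [X] / K ≤ E [exp (X / K)] - 1`. -/
lemma integral_le_of_lintegral_exp_le [IsProbabilityMeasure P] {X : S → ℝ} (hX : Measurable X)
    (hX0 : ∀ s, 0 ≤ X s) {K : ℝ} (hK : 0 < K)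
    (h : ∫⁻ s, ENNReal.ofReal (Real.exp (X s / K)) ∂P ≤ 2) : ∫ s, X s ∂P ≤ K := by
  have hint : Integrable X P := by
    refine integrable_of_lintegral_exp_le hX.aestronglyMeasurable hK (by simp : (2 : ℝ≥0∞) ≠ ⊤) ?_
    simpa [abs_of_nonneg (hX0 _)] using h
  have hexp : Integrable (fun s => Real.exp (X s / K)) P := by
    refine ⟨(Real.measurable_exp.comp (hX.div_const K)).aestronglyMeasurable, ?_⟩
    rw [hasFiniteIntegral_iff_ofReal (by filter_upwards with s using (Real.exp_pos _).le)]
    exact h.trans_lt (by simp)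
  have h2 : ∫ s, Real.exp (X s / K) ∂P ≤ 2 := by
    rw [integral_eq_lintegral_of_nonneg_ae (by filter_upwards with s using (Real.exp_pos _).le)
      hexp.aestronglyMeasurable]
    exact ENNReal.toReal_le_of_le_ofReal (by norm_num) (by simpa using h)
  have h3 : ∫ s, (X s / K + 1) ∂P ≤ ∫ s, Real.exp (X s / K) ∂P :=
    integral_mono ((hint.div_const K).add (integrable_const 1)) hexp
      fun s => Real.add_one_le_exp _
  rw [integral_add (hint.div_const K) (integrable_const 1), integral_div] at h3
  simp at h3
  have : (∫ s, X s ∂P) / K ≤ 1 := by linarith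
  rwa [div_le_one hK] at this

end expMoment

/-! ### The gradient and the Hessian of the mean loss -/

section population

variable {d : ℕ} {S : Type*} [MeasurableSpace S] {P : Measure S} {f : S → SGDM.E d → ℝ}
  {xs : SGDM.E d}

/-- The random smoothness constant, with the supremum restricted to a countable dense set. This
makes it measurable in the sample without changing what it says about a continuous gradient. -/
noncomputable def denseGradLip (F : SGDM.E d → ℝ) (xs : SGDM.E d) : ℝ≥0∞ :=
  ⨆ n : ℕ, ‖gradient F (TopologicalSpace.denseSeq (SGDM.E d) n) - gradient F xs‖ₑ /
    ‖TopologicalSpace.denseSeq (SGDM.E d) n - xs‖ₑ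

lemma denseGradLip_le_gradLip (F : SGDM.E d → ℝ) (xs : SGDM.E d) :
    denseGradLip F xs ≤ SGDM.gradLip F xs :=
  iSup_le fun _ => le_iSup (fun x => ‖gradient F x - gradient F xs‖ₑ / ‖x - xs‖ₑ) _

lemma measurable_denseGradLip (hm : ∀ x, Measurable fun s => f s x)
    (hf : ∀ s, Differentiable ℝ (f s)) (xs : SGDM.E d) :
    Measurable fun s => denseGradLip (f s) xs :=
  Measurable.iSup fun _ =>
    ((measurable_gradient hm hf _).sub (measurable_gradient hm hf _)).enorm.div_const _

lemma norm_gradient_sub_le_denseGradLip {F : SGDM.E d → ℝ} (hF : Continuous (gradient F))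
    (h : denseGradLip F xs ≠ ⊤) (x : SGDM.E d) :
    ‖gradient F x - gradient F xs‖ ≤ (denseGradLip F xs).toReal * ‖x - xs‖ := by
  refine (TopologicalSpace.denseRange_denseSeq (SGDM.E d)).induction_on
    (p := fun x => ‖gradient F x - gradient F xs‖ ≤ (denseGradLip F xs).toReal * ‖x - xs‖) x ?_ ?_
  · exact isClosed_le (by fun_prop) (by fun_prop)
  · intro n
    set u := TopologicalSpace.denseSeq (SGDM.E d) n
    by_cases hu : u = xs
    · simp [hu]
    have h1 : ‖gradient F u - gradient F xs‖ₑ / ‖u - xs‖ₑ ≤ denseGradLip F xs :=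
      le_iSup (fun n : ℕ => ‖gradient F (TopologicalSpace.denseSeq (SGDM.E d) n) -
        gradient F xs‖ₑ / ‖TopologicalSpace.denseSeq (SGDM.E d) n - xs‖ₑ) n
    rw [ENNReal.div_le_iff (by simpa [sub_eq_zero] using hu) (by simp)] at h1
    have h2 := (ENNReal.toReal_le_toReal (by simp) (ENNReal.mul_ne_top h (by simp))).mpr h1
    simpa using h2

/-- A measurable real-valued version of the random smoothness constant; it is valid for almost every
sample, namely where the supremum is finite. -/
lemma exists_measurable_smoothness (hm : ∀ x, Measurable fun s => f s x)
    (hf : ∀ s, SGDM.TwiceDifferentiable (f s)) {Lf : ℝ} (hLf : 0 < Lf)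
    (h : ∫⁻ s, EReal.exp ((SGDM.gradLip (f s) xs / ENNReal.ofReal Lf : ℝ≥0∞) : EReal) ∂P ≤ 2) :
    ∃ Λ : S → ℝ, Measurable Λ ∧ (∀ s, 0 ≤ Λ s) ∧
      (∀ᵐ s ∂P, ∀ x, ‖gradient (f s) x - gradient (f s) xs‖ ≤ Λ s * ‖x - xs‖) ∧
      ∫⁻ s, ENNReal.ofReal (Real.exp (Λ s / Lf)) ∂P ≤ 2 := by
  have hmeas := measurable_denseGradLip hm (fun s => (hf s).1) xs
  have hle : ∫⁻ s, EReal.exp ((denseGradLip (f s) xs / ENNReal.ofReal Lf : ℝ≥0∞) : EReal) ∂P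
      ≤ 2 := by
    refine (lintegral_mono fun s => EReal.exp_monotone ?_).trans h
    exact_mod_cast ENNReal.div_le_div_right (denseGradLip_le_gradLip _ _) _
  have hmexp : Measurable fun s =>
      EReal.exp ((denseGradLip (f s) xs / ENNReal.ofReal Lf : ℝ≥0∞) : EReal) :=
    EReal.measurable_exp.comp (hmeas.div_const _).coe_ereal_ennreal
  have hfin : ∀ᵐ s ∂P, denseGradLip (f s) xs ≠ ⊤ := by
    filter_upwards [ae_lt_top hmexp (hle.trans_lt (by simp)).ne] with s hs htop
    rw [EReal.exp_lt_top_iff, htop, ENNReal.top_div_of_ne_top (by simp)] at hs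
    simp at hs
  refine ⟨fun s => (denseGradLip (f s) xs).toReal, hmeas.ennreal_toReal,
    fun s => ENNReal.toReal_nonneg, ?_, ?_⟩
  · filter_upwards [hfin] with s hs x
    exact norm_gradient_sub_le_denseGradLip (hf s).2.continuous hs x
  · refine le_trans (le_of_eq (lintegral_congr_ae ?_)) hle
    filter_upwards [hfin] with s hs
    have : (denseGradLip (f s) xs / ENNReal.ofReal Lf : ℝ≥0∞) =
        ENNReal.ofReal ((denseGradLip (f s) xs).toReal / Lf) := by
      rw [ENNReal.ofReal_div_of_pos hLf, ENNReal.ofReal_toReal hs]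
    rw [this, EReal.coe_ennreal_ofReal, max_eq_left (by positivity), EReal.exp_coe]

variable {Λ : S → ℝ}

lemma integrable_gradient (hm : ∀ x, Measurable fun s => f s x)
    (hf : ∀ s, SGDM.TwiceDifferentiable (f s)) (hΛ : Integrable Λ P)
    (hlip : ∀ᵐ s ∂P, ∀ x, ‖gradient (f s) x - gradient (f s) xs‖ ≤ Λ s * ‖x - xs‖)
    (hxs : Integrable (fun s => gradient (f s) xs) P) (x : SGDM.E d) :
    Integrable (fun s => gradient (f s) x) P := by
  have hg := measurable_gradient hm fun s => (hf s).1
  have h : Integrable (fun s => gradient (f s) x - gradient (f s) xs) P := by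
    refine (hΛ.mul_const ‖x - xs‖).mono' ((hg x).sub (hg xs)).aestronglyMeasurable ?_
    filter_upwards [hlip] with s hs using hs x
  exact (h.add hxs).congr (.of_forall fun s => sub_add_cancel _ _)

/-- Differentiation under the expectation, dominated by the random smoothness constant. -/
lemma gradient_meanLoss (hm : ∀ x, Measurable fun s => f s x)
    (hint : ∀ x, Integrable (fun s => f s x) P)
    (hf : ∀ s, SGDM.TwiceDifferentiable (f s)) (hΛ : Integrable Λ P) (hΛ0 : ∀ s, 0 ≤ Λ s)
    (hlip : ∀ᵐ s ∂P, ∀ x, ‖gradient (f s) x - gradient (f s) xs‖ ≤ Λ s * ‖x - xs‖)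
    (hxs : Integrable (fun s => gradient (f s) xs) P) (x : SGDM.E d) :
    gradient (SGDM.meanLoss P f) x = ∫ s, gradient (f s) x ∂P := by
  have hg := measurable_gradient hm fun s => (hf s).1
  have hgi := integrable_gradient hm hf hΛ hlip hxs
  have hmeas' : ∀ y, AEStronglyMeasurable (fun s => innerSL ℝ (gradient (f s) y)) P := fun y =>
    (innerSL ℝ).continuous.comp_aestronglyMeasurable (hg y).aestronglyMeasurable
  have hD := hasFDerivAt_integral_of_dominated_of_fderiv_le (μ := P) (𝕜 := ℝ)
    (F := fun y s => f s y) (F' := fun y s => innerSL ℝ (gradient (f s) y)) (x₀ := x)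
    (s := Metric.ball x 1)
    (bound := fun s => Λ s * (‖x - xs‖ + 1) + ‖gradient (f s) xs‖)
    (Metric.ball_mem_nhds x one_pos) (.of_forall fun y => (hm y).aestronglyMeasurable) (hint x)
    (hmeas' x) ?_ ((hΛ.mul_const _).add hxs.norm) ?_
  · refine ext_inner_left ℝ fun v => ?_
    have hi : Integrable (fun s => innerSL ℝ (gradient (f s) x)) P := by
      refine (hgi x).norm.mono' (hmeas' x) (.of_forall fun s => ?_)
      rw [innerSL_apply_norm]
    rw [inner_gradient_eq_fderiv, ← integral_inner (hgi x),
      show SGDM.meanLoss P f = fun x => ∫ s, f s x ∂P from rfl, hD.fderiv,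
      ContinuousLinearMap.integral_apply hi]
    simp only [innerSL_apply_apply, real_inner_comm]
  · filter_upwards [hlip] with s hs y hy
    rw [innerSL_apply_norm]
    have h1 : ‖y - xs‖ ≤ ‖x - xs‖ + 1 := by
      rw [Metric.mem_ball, dist_eq_norm] at hy
      calc ‖y - xs‖ = ‖(y - x) + (x - xs)‖ := by congr 1; abel
        _ ≤ ‖y - x‖ + ‖x - xs‖ := norm_add_le _ _
        _ ≤ _ := by linarith
    calc ‖gradient (f s) y‖ = ‖(gradient (f s) y - gradient (f s) xs) + gradient (f s) xs‖ := by
          congr 1; abel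
      _ ≤ ‖gradient (f s) y - gradient (f s) xs‖ + ‖gradient (f s) xs‖ := norm_add_le _ _
      _ ≤ Λ s * ‖y - xs‖ + ‖gradient (f s) xs‖ := by gcongr; exact hs y
      _ ≤ _ := by
        have := hΛ0 s
        gcongr
  · exact .of_forall fun s y _ => hasFDerivAt_innerSL_gradient (hf s).1 y

/-- The mean Hessian at `xs` is the Hessian of the mean loss: the difference quotients of the
gradients are dominated by the random smoothness constant. -/
lemma meanHessian_eq_hessian_meanLoss (hm : ∀ x, Measurable fun s => f s x)
    (hint : ∀ x, Integrable (fun s => f s x) P)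
    (hf : ∀ s, SGDM.TwiceDifferentiable (f s)) (hΛ : Integrable Λ P) (hΛ0 : ∀ s, 0 ≤ Λ s)
    (hlip : ∀ᵐ s ∂P, ∀ x, ‖gradient (f s) x - gradient (f s) xs‖ ≤ Λ s * ‖x - xs‖)
    (hxs : Integrable (fun s => gradient (f s) xs) P)
    (hmean : SGDM.TwiceDifferentiable (SGDM.meanLoss P f)) :
    SGDM.meanHessian P f xs = SGDM.hessian (SGDM.meanLoss P f) xs := by
  have hg := measurable_gradient hm fun s => (hf s).1
  have hgi := integrable_gradient hm hf hΛ hlip hxs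
  ext i j
  set v : SGDM.E d := EuclideanSpace.single j (1 : ℝ) with hv
  have hproj : ∀ w : SGDM.E d, (EuclideanSpace.proj i : SGDM.E d →L[ℝ] ℝ) w = w i := fun w => rfl
  have hlim := tendsto_difference_quotient (hmean.2 xs) v
  have hlim1 := ((EuclideanSpace.proj i : SGDM.E d →L[ℝ] ℝ).continuous.tendsto _).comp hlim
  have hlim2 : Filter.Tendsto (fun n : ℕ => ∫ s, (EuclideanSpace.proj i : SGDM.E d →L[ℝ] ℝ)
      ((n : ℝ) • (gradient (f s) (xs + (n : ℝ)⁻¹ • v) - gradient (f s) xs)) ∂P) Filter.atTop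
      (nhds (∫ s, SGDM.hessian (f s) xs i j ∂P)) := by
    refine tendsto_integral_of_dominated_convergence (fun s => Λ s * ‖v‖) (fun n => ?_)
      (hΛ.mul_const _) (fun n => ?_) ?_
    · exact (EuclideanSpace.proj i : SGDM.E d →L[ℝ] ℝ).continuous.comp_aestronglyMeasurable
        (((hg (xs + (n : ℝ)⁻¹ • v)).sub (hg xs)).const_smul (n : ℝ)).aestronglyMeasurable
    · filter_upwards [hlip] with s hs
      rw [hproj]
      refine (PiLp.norm_apply_le _ i).trans ?_
      rw [norm_smul]
      rcases Nat.eq_zero_or_pos n with rfl | hn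
      · simpa using mul_nonneg (hΛ0 s) (norm_nonneg v)
      have hn' : (0 : ℝ) < n := by exact_mod_cast hn
      calc ‖(n : ℝ)‖ * ‖gradient (f s) (xs + (n : ℝ)⁻¹ • v) - gradient (f s) xs‖
          ≤ n * (Λ s * ‖(xs + (n : ℝ)⁻¹ • v) - xs‖) := by
            rw [Real.norm_of_nonneg hn'.le]
            gcongr
            exact hs _
        _ = Λ s * ‖v‖ := by
            rw [add_sub_cancel_left, norm_smul, norm_inv, Real.norm_of_nonneg hn'.le]
            field_simp
    · refine .of_forall fun s => ?_
      exact ((EuclideanSpace.proj i : SGDM.E d →L[ℝ] ℝ).continuous.tendsto _).comp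
        (tendsto_difference_quotient ((hf s).2 xs) v)
  refine tendsto_nhds_unique hlim2 (hlim1.congr fun n => ?_)
  have hi : Integrable (fun s => (n : ℝ) •
      (gradient (f s) (xs + (n : ℝ)⁻¹ • v) - gradient (f s) xs)) P :=
    ((hgi (xs + (n : ℝ)⁻¹ • v)).sub (hgi xs)).smul (n : ℝ)
  rw [Function.comp_apply, ContinuousLinearMap.integral_comp_comm _ hi, integral_smul,
    integral_sub (hgi _) (hgi _),
    gradient_meanLoss hm hint hf hΛ hΛ0 hlip hxs, gradient_meanLoss hm hint hf hΛ hΛ0 hlip hxs]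

end population

/-! ### Sub-exponential random variables -/

section subexponential

variable {S : Type*} [MeasurableSpace S] {P : Measure S} [IsProbabilityMeasure P]

lemma exp_le_one_add_add_sq_mul_exp_abs (x : ℝ) :
    Real.exp x ≤ 1 + x + x ^ 2 * Real.exp |x| := by
  have h := Complex.norm_exp_sub_sum_le_norm_mul_exp (x : ℂ) 2
  have e : Complex.exp x - ∑ m ∈ Finset.range 2, (x : ℂ) ^ m / (m.factorial : ℂ) =
      ((Real.exp x - (1 + x) : ℝ) : ℂ) := by
    simp [Finset.sum_range_succ]
  rw [e, Complex.norm_real, Complex.norm_real, Real.norm_eq_abs, Real.norm_eq_abs, sq_abs] at h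
  linarith [le_abs_self (Real.exp x - (1 + x))]

/-- With `a = |x| / K` and `|θ| K ≤ 1 / 2`, the quadratic error `θ² x² exp |θ x|` is at most
`θ² K² a² exp (a / 2)`, and `a² ≤ 8 exp (a / 2)`. -/
lemma exp_mul_le_of_abs_mul_le {K θ : ℝ} (hK : 0 < K) (hθ : |θ| * K ≤ 1 / 2) (x : ℝ) :
    Real.exp (θ * x) ≤ 1 + θ * x + 8 * θ ^ 2 * K ^ 2 * Real.exp (|x| / K) := by
  set a := |x| / K with ha
  have ha0 : 0 ≤ a := by positivity
  have hx : |x| = K * a := by rw [ha]; field_simp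
  have h1 : |θ * x| ≤ a / 2 := by
    rw [abs_mul, hx, ← mul_assoc]
    calc |θ| * K * a ≤ 1 / 2 * a := by gcongr
      _ = a / 2 := by ring
  have h2 : a ^ 2 ≤ 8 * Real.exp (a / 2) := by
    have := Real.quadratic_le_exp_of_nonneg (x := a / 2) (by positivity)
    nlinarith
  have h3 : (θ * x) ^ 2 = θ ^ 2 * K ^ 2 * a ^ 2 := by
    rw [mul_pow, ← sq_abs x, hx]; ring
  have h4 : Real.exp a = Real.exp (a / 2) * Real.exp (a / 2) := by
    rw [← Real.exp_add]; ring_nf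
  calc Real.exp (θ * x) ≤ 1 + θ * x + (θ * x) ^ 2 * Real.exp |θ * x| :=
        exp_le_one_add_add_sq_mul_exp_abs _
    _ ≤ 1 + θ * x + θ ^ 2 * K ^ 2 * (8 * Real.exp (a / 2)) * Real.exp (a / 2) := by
        rw [h3]
        gcongr
    _ = _ := by rw [h4]; ring

/-- A centered sub-exponential random variable has a sub-Gaussian moment generating function near
the origin. -/
lemma lintegral_exp_mul_le {X : S → ℝ} (hX : Measurable X) (hX0 : ∫ s, X s ∂P = 0) {K θ : ℝ}
    (hK : 0 < K) (hθ : |θ| * K ≤ 1 / 2)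
    (h : ∫⁻ s, ENNReal.ofReal (Real.exp (|X s| / K)) ∂P ≤ 6) :
    ∫⁻ s, ENNReal.ofReal (Real.exp (θ * X s)) ∂P ≤
      ENNReal.ofReal (Real.exp (48 * (θ ^ 2 * K ^ 2))) := by
  have hint := integrable_of_lintegral_exp_le hX.aestronglyMeasurable hK
    (by simp : (6 : ℝ≥0∞) ≠ ⊤) h
  have hmexp : Measurable fun s => Real.exp (|X s| / K) := by fun_prop
  have hexp : Integrable (fun s => Real.exp (|X s| / K)) P := by
    refine ⟨hmexp.aestronglyMeasurable, ?_⟩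
    rw [hasFiniteIntegral_iff_ofReal (.of_forall fun s => (Real.exp_pos _).le)]
    exact h.trans_lt (by simp)
  have h6 : ∫ s, Real.exp (|X s| / K) ∂P ≤ 6 := by
    rw [integral_eq_lintegral_of_nonneg_ae (.of_forall fun s => (Real.exp_pos _).le)
      hexp.aestronglyMeasurable]
    exact ENNReal.toReal_le_of_le_ofReal (by norm_num) (by simpa using h)
  have hr : Integrable (fun s => 1 + θ * X s + 8 * θ ^ 2 * K ^ 2 * Real.exp (|X s| / K)) P :=
    ((integrable_const 1).add (hint.const_mul θ)).add (hexp.const_mul _)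
  calc ∫⁻ s, ENNReal.ofReal (Real.exp (θ * X s)) ∂P
      ≤ ∫⁻ s, ENNReal.ofReal
          (1 + θ * X s + 8 * θ ^ 2 * K ^ 2 * Real.exp (|X s| / K)) ∂P :=
        lintegral_mono fun s => ENNReal.ofReal_le_ofReal (exp_mul_le_of_abs_mul_le hK hθ _)
    _ = ENNReal.ofReal
          (∫ s, (1 + θ * X s + 8 * θ ^ 2 * K ^ 2 * Real.exp (|X s| / K)) ∂P) :=
        (ofReal_integral_eq_lintegral_ofReal hr (.of_forall fun s =>
          (Real.exp_pos _).le.trans (exp_mul_le_of_abs_mul_le hK hθ (X s)))).symm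
    _ ≤ _ := by
        apply ENNReal.ofReal_le_ofReal
        have h1 : Integrable (fun s => 1 + θ * X s) P :=
          (integrable_const 1).add (hint.const_mul θ)
        rw [integral_add h1 (hexp.const_mul _),
          integral_add (integrable_const 1) (hint.const_mul θ), integral_const_mul,
          integral_const_mul, hX0]
        have h7 : 8 * θ ^ 2 * K ^ 2 * ∫ s, Real.exp (|X s| / K) ∂P ≤
            8 * θ ^ 2 * K ^ 2 * 6 := by gcongr
        simp
        linarith [Real.add_one_le_exp (48 * (θ ^ 2 * K ^ 2))]

lemma lintegral_exp_inner_le {d : ℕ} {X : S → SGDM.E d} (hX : Measurable X)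
    (hXi : Integrable X P) (hX0 : ∫ s, X s ∂P = 0) {K : ℝ} (hK : 0 < K)
    (h : ∀ v : SGDM.E d, ‖v‖ = 1 →
      ∫⁻ s, ENNReal.ofReal (Real.exp (|inner ℝ v (X s)| / K)) ∂P ≤ 6)
    {w : SGDM.E d} (hw : ‖w‖ * K ≤ 1 / 2) :
    ∫⁻ s, ENNReal.ofReal (Real.exp (inner ℝ w (X s))) ∂P ≤
      ENNReal.ofReal (Real.exp (48 * (‖w‖ ^ 2 * K ^ 2))) := by
  rcases eq_or_ne w 0 with rfl | hw0
  · simp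
  have hn : ‖w‖ ≠ 0 := norm_ne_zero_iff.mpr hw0
  set v := ‖w‖⁻¹ • w with hv
  have hv1 : ‖v‖ = 1 := by rw [hv, norm_smul, norm_inv, norm_norm, inv_mul_cancel₀ hn]
  have hwv : ∀ s, inner ℝ w (X s) = ‖w‖ * inner ℝ v (X s) := by
    intro s
    rw [hv, real_inner_smul_left, ← mul_assoc, mul_inv_cancel₀ hn, one_mul]
  simp only [hwv]
  refine lintegral_exp_mul_le (hX.const_inner) ?_ hK (by rwa [abs_norm]) (h v hv1)
  rw [integral_inner hXi, hX0, inner_zero_right]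

end subexponential

/-! ### Independence of a batch from the past -/

section independence

variable {S Ω : Type*} [MeasurableSpace S] {B : ℕ}

/-- The σ-algebra generated by the batches with index less than `t`. -/
abbrev pastAlgebra (ξ : ℕ → Fin B → Ω → S) (t : ℕ) : MeasurableSpace Ω :=
  ⨆ p ∈ {p : ℕ × Fin B | p.1 < t}, MeasurableSpace.comap (ξ p.1 p.2) inferInstance

lemma pastAlgebra_mono (ξ : ℕ → Fin B → Ω → S) {s t : ℕ} (h : s ≤ t) :
    pastAlgebra ξ s ≤ pastAlgebra ξ t :=
  biSup_mono fun _ hp => lt_of_lt_of_le hp h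

lemma measurable_sample_pastAlgebra (ξ : ℕ → Fin B → Ω → S) {s t : ℕ} (h : s < t) (i : Fin B) :
    Measurable[pastAlgebra ξ t] (ξ s i) :=
  (comap_measurable (ξ s i)).mono (le_iSup₂ (f := fun (p : ℕ × Fin B)
    (_ : p ∈ {p : ℕ × Fin B | p.1 < t}) => MeasurableSpace.comap (ξ p.1 p.2) inferInstance)
    (s, i) h) le_rfl

variable [MeasurableSpace Ω] {P : Measure S} {Pr : Measure Ω} {ξ : ℕ → Fin B → Ω → S}

lemma pastAlgebra_le (hξ : ∀ t i, Measurable (ξ t i)) (t : ℕ) :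
    pastAlgebra ξ t ≤ (inferInstance : MeasurableSpace Ω) :=
  iSup₂_le fun p _ => (hξ p.1 p.2).comap_le

/-- Anything determined by the earlier batches is independent of the current batch. -/
lemma indepFun_past_batch [IsProbabilityMeasure Pr] (hξ : ∀ t i, Measurable (ξ t i))
    (hind : iIndepFun (fun p : ℕ × Fin B => ξ p.1 p.2) Pr) (t : ℕ) {V : Type*}
    [MeasurableSpace V] {Y : Ω → V} (hY : Measurable[pastAlgebra ξ t] Y) :
    IndepFun Y (fun ω i => ξ t i ω) Pr := by
  have h := indep_iSup_of_disjoint (fun p : ℕ × Fin B => (hξ p.1 p.2).comap_le) hind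
    (S := {p : ℕ × Fin B | p.1 < t}) (T := {p : ℕ × Fin B | p.1 = t})
    (Set.disjoint_left.mpr fun p hp hp' => (lt_irrefl t (by rwa [Set.mem_ofPred_eq, hp'] at hp)))
  refine indep_of_indep_of_le_left (indep_of_indep_of_le_right h ?_) hY.comap_le
  refine ((@measurable_pi_iff Ω (Fin B) (fun _ => S) (_) _ _).mpr fun i => ?_).comap_le
  exact (comap_measurable (ξ t i)).mono (le_iSup₂ (f := fun (p : ℕ × Fin B)
    (_ : p ∈ {p : ℕ × Fin B | p.1 = t}) => MeasurableSpace.comap (ξ p.1 p.2) inferInstance)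
    (t, i) rfl) le_rfl

/-- The factorization of the exponential moment of a sum over an i.i.d. batch. -/
lemma lintegral_exp_sum_batch_le [IsProbabilityMeasure Pr]
    (hlaw : ∀ t i, MeasurePreserving (ξ t i) Pr P)
    (hind : iIndepFun (fun p : ℕ × Fin B => ξ p.1 p.2) Pr) (t : ℕ) {φ : S → ℝ}
    (hφ : Measurable φ) {c : ℝ}
    (h : ∫⁻ s, ENNReal.ofReal (Real.exp (φ s)) ∂P ≤ ENNReal.ofReal (Real.exp c)) :
    ∫⁻ ω, ENNReal.ofReal (Real.exp (∑ i, φ (ξ t i ω))) ∂Pr ≤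
      ENNReal.ofReal (Real.exp (B * c)) := by
  have hg : Measurable fun s => ENNReal.ofReal (Real.exp (φ s)) := by fun_prop
  have hind' : iIndepFun (fun i => ξ t i) Pr :=
    hind.precomp (g := fun i : Fin B => (t, i)) fun i j h => by simpa using h
  have hprod := lintegral_prod_eq_prod_lintegral_of_indepFun Finset.univ
    (fun i ω => ENNReal.ofReal (Real.exp (φ (ξ t i ω))))
    (hind'.comp (fun _ s => ENNReal.ofReal (Real.exp (φ s))) fun _ => hg)
    fun i => hg.comp (hlaw t i).measurable
  calc ∫⁻ ω, ENNReal.ofReal (Real.exp (∑ i, φ (ξ t i ω))) ∂Pr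
      = ∫⁻ ω, ∏ i, ENNReal.ofReal (Real.exp (φ (ξ t i ω))) ∂Pr := by
        refine lintegral_congr fun ω => ?_
        rw [Real.exp_sum, ENNReal.ofReal_prod_of_nonneg fun i _ => (Real.exp_pos _).le]
    _ = ∏ i : Fin B, ∫⁻ s, ENNReal.ofReal (Real.exp (φ s)) ∂P := by
        rw [hprod]
        exact Finset.prod_congr rfl fun i _ => (hlaw t i).lintegral_comp hg
    _ ≤ ∏ i : Fin B, ENNReal.ofReal (Real.exp c) := by gcongr
    _ = _ := by
        rw [Finset.prod_const, Finset.card_univ, Fintype.card_fin, ← ENNReal.ofReal_pow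
          (Real.exp_pos _).le, ← Real.exp_nat_mul]

/-- The exponential moment of an adapted sum: conditionally on the past, each batch contributes
at most the factor `exp (B c_j)`. -/
lemma lintegral_exp_adapted_sum_le [IsProbabilityMeasure Pr] {V : Type*} [MeasurableSpace V]
    (hlaw : ∀ t i, MeasurePreserving (ξ t i) Pr P)
    (hind : iIndepFun (fun p : ℕ × Fin B => ξ p.1 p.2) Pr) {x : ℕ → Ω → V}
    (hx : ∀ t, Measurable[pastAlgebra ξ t] (x t)) {φ : ℕ → S → V → ℝ}
    (hφ : ∀ j, Measurable (Function.uncurry (φ j))) {c : ℕ → ℝ} (t : ℕ)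
    (h : ∀ j ∈ Finset.Icc 1 t, ∀ y,
      ∫⁻ s, ENNReal.ofReal (Real.exp (φ j s y)) ∂P ≤ ENNReal.ofReal (Real.exp (c j))) :
    ∫⁻ ω, ENNReal.ofReal (Real.exp
        (∑ j ∈ Finset.Icc 1 t, ∑ i, φ j (ξ j i ω) (x j ω))) ∂Pr ≤
      ENNReal.ofReal (Real.exp (B * ∑ j ∈ Finset.Icc 1 t, c j)) := by
  induction t with
  | zero => simp
  | succ t ih =>
    have ih := ih fun j hj => h j (Finset.Icc_subset_Icc_right t.le_succ hj)
    have hξ : ∀ t i, Measurable (ξ t i) := fun t i => (hlaw t i).measurable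
    have hxm : ∀ t, Measurable (x t) := fun t => (hx t).mono (pastAlgebra_le hξ t) le_rfl
    set F : Ω → ℝ := fun ω => ∑ j ∈ Finset.Icc 1 t, ∑ i, φ j (ξ j i ω) (x j ω) with hF
    have hFm : Measurable[pastAlgebra ξ (t + 1)] F := by
      refine Finset.measurable_fun_sum _ fun j hj => Finset.measurable_fun_sum _ fun i _ => ?_
      have hj' : j < t + 1 := Nat.lt_succ_of_le (Finset.mem_Icc.mp hj).2
      exact (hφ j).comp ((measurable_sample_pastAlgebra ξ hj' i).prodMk
        ((hx j).mono (pastAlgebra_mono ξ hj'.le) le_rfl))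
    have hF' : Measurable F := hFm.mono (pastAlgebra_le hξ _) le_rfl
    -- `Y` collects what the past contributes, `X` is the fresh batch
    set Y : Ω → ℝ × V := fun ω => (F ω, x (t + 1) ω)
    set X : Ω → Fin B → S := fun ω i => ξ (t + 1) i ω
    have hYm : Measurable Y := hF'.prodMk (hxm _)
    have hXm : Measurable X := measurable_pi_iff.mpr fun i => hξ _ i
    have hYX : IndepFun Y X Pr :=
      indepFun_past_batch hξ hind (t + 1) (hFm.prodMk (hx (t + 1)))
    have hmap := (indepFun_iff_map_prod_eq_prod_map_map hYm.aemeasurable hXm.aemeasurable).mp hYX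
    set g : (ℝ × V) × (Fin B → S) → ℝ≥0∞ := fun p =>
      ENNReal.ofReal (Real.exp p.1.1) *
        ENNReal.ofReal (Real.exp (∑ i, φ (t + 1) (p.2 i) p.1.2)) with hg
    have hgm : Measurable g := by
      have h1 : Measurable fun p : (ℝ × V) × (Fin B → S) =>
          ∑ i, φ (t + 1) (p.2 i) p.1.2 :=
        Finset.measurable_fun_sum _ fun i _ => Measurable.comp
          (f := fun p : (ℝ × V) × (Fin B → S) => (p.2 i, p.1.2)) (hφ (t + 1))
          (((measurable_pi_apply i).comp measurable_snd).prodMk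
            (measurable_snd.comp measurable_fst))
      exact (ENNReal.measurable_ofReal.comp (Real.measurable_exp.comp
        (measurable_fst.comp measurable_fst))).mul
        (ENNReal.measurable_ofReal.comp (Real.measurable_exp.comp h1))
    have hXprob := Measure.isProbabilityMeasure_map (μ := Pr) hXm.aemeasurable
    calc ∫⁻ ω, ENNReal.ofReal (Real.exp
          (∑ j ∈ Finset.Icc 1 (t + 1), ∑ i, φ j (ξ j i ω) (x j ω))) ∂Pr
        = ∫⁻ ω, g (Y ω, X ω) ∂Pr := by
          refine lintegral_congr fun ω => ?_
          rw [Finset.sum_Icc_succ_top (by omega), Real.exp_add,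
            ENNReal.ofReal_mul (Real.exp_pos _).le]
      _ = ∫⁻ p, g p ∂((Measure.map Y Pr).prod (Measure.map X Pr)) := by
          rw [← hmap, lintegral_map hgm (hYm.prodMk hXm)]
      _ = ∫⁻ y, ∫⁻ z, g (y, z) ∂(Measure.map X Pr) ∂(Measure.map Y Pr) :=
          lintegral_prod _ hgm.aemeasurable
      _ ≤ ∫⁻ y, ENNReal.ofReal (Real.exp y.1) * ENNReal.ofReal (Real.exp (B * c (t + 1)))
            ∂(Measure.map Y Pr) := by
          refine lintegral_mono fun y => ?_
          refine (le_of_eq (lintegral_map (hgm.comp measurable_prodMk_left) hXm)).trans ?_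
          simp only [hg, Function.comp_apply]
          rw [lintegral_const_mul' _ _ ENNReal.ofReal_ne_top]
          gcongr
          refine lintegral_exp_sum_batch_le hlaw hind (t + 1) (φ := fun s => φ (t + 1) s y.2)
            ((hφ (t + 1)).comp measurable_prodMk_right) ?_
          exact h (t + 1) (by simp) y.2
      _ = (∫⁻ ω, ENNReal.ofReal (Real.exp (F ω)) ∂Pr) *
            ENNReal.ofReal (Real.exp (B * c (t + 1))) := by
          rw [lintegral_map (by fun_prop) hYm, lintegral_mul_const' _ _ ENNReal.ofReal_ne_top]
      _ ≤ ENNReal.ofReal (Real.exp (B * ∑ j ∈ Finset.Icc 1 t, c j)) *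
            ENNReal.ofReal (Real.exp (B * c (t + 1))) := by gcongr
      _ = _ := by
          rw [← ENNReal.ofReal_mul (Real.exp_pos _).le, ← Real.exp_add,
            Finset.sum_Icc_succ_top (by omega), mul_add]

end independence

/-! ### Norms of random vectors from their exponential moments -/

section ballAverage

variable {d : ℕ}

/-- The ball of radius `r / 4` around `(r / 2) z / ‖z‖` lies in the ball of radius `r`, and
`⟨v, z⟩ ≥ r ‖z‖ / 4` on it. -/
lemma exp_norm_mul_volume_le {r : ℝ} (hr : 0 < r) (z : SGDM.E d) :
    ENNReal.ofReal (Real.exp (r * ‖z‖ / 4)) * volume (Metric.ball (0 : SGDM.E d) r) ≤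
      4 ^ d * ∫⁻ v in Metric.ball (0 : SGDM.E d) r,
        ENNReal.ofReal (Real.exp (inner ℝ v z)) := by
  set u : SGDM.E d := (r / 2) • (‖z‖⁻¹ • z) with hu
  have hu1 : ‖u‖ ≤ r / 2 := by
    rw [hu, norm_smul, norm_smul, norm_inv, norm_norm, Real.norm_of_nonneg (by positivity)]
    have : ‖z‖⁻¹ * ‖z‖ ≤ 1 := inv_mul_le_one
    nlinarith
  have huz : inner ℝ u z = r / 2 * ‖z‖ := by
    rw [hu, real_inner_smul_left, real_inner_smul_left, real_inner_self_eq_norm_sq]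
    rcases eq_or_ne ‖z‖ 0 with h | h
    · simp [h]
    · field_simp
  have hsub : Metric.ball u (r / 4) ⊆ Metric.ball 0 r := by
    refine Metric.ball_subset_ball' ?_
    rw [dist_zero_right]
    linarith
  have hvol : volume (Metric.ball (0 : SGDM.E d) r) =
      4 ^ d * volume (Metric.ball u (r / 4)) := by
    rw [Measure.addHaar_ball_of_pos _ _ hr, Measure.addHaar_ball_of_pos _ u (by positivity : 0 < r / 4),
      finrank_euclideanSpace_fin, ← mul_assoc]
    congr 1
    rw [show (4 : ℝ≥0∞) = ENNReal.ofReal 4 by simp, ← ENNReal.ofReal_pow (by norm_num),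
      ← ENNReal.ofReal_mul (by positivity), ← mul_pow]
    congr 2
    ring
  rw [hvol, mul_left_comm]
  gcongr
  calc ENNReal.ofReal (Real.exp (r * ‖z‖ / 4)) * volume (Metric.ball u (r / 4))
      = ∫⁻ _ in Metric.ball u (r / 4), ENNReal.ofReal (Real.exp (r * ‖z‖ / 4)) := by
        rw [setLIntegral_const]
    _ ≤ ∫⁻ v in Metric.ball u (r / 4), ENNReal.ofReal (Real.exp (inner ℝ v z)) := by
        refine setLIntegral_mono' measurableSet_ball fun v hv => ?_
        apply ENNReal.ofReal_le_ofReal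
        apply Real.exp_le_exp.mpr
        have h1 : inner ℝ v z = inner ℝ (v - u) z + inner ℝ u z := by
          rw [inner_sub_left]; ring
        have h2 := neg_le_of_abs_le (abs_real_inner_le_norm (v - u) z)
        rw [Metric.mem_ball, dist_eq_norm] at hv
        have h3 : ‖v - u‖ * ‖z‖ ≤ r / 4 * ‖z‖ := by gcongr
        rw [h1, huz]
        linarith
    _ ≤ _ := lintegral_mono_set hsub

/-- Averaging the exponential moments of the one-dimensional marginals over a ball replaces a
covering argument. -/
lemma lintegral_exp_norm_le {Ω : Type*} [MeasurableSpace Ω] {Pr : Measure Ω}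
    [IsProbabilityMeasure Pr] {Z : Ω → SGDM.E d} (hZ : Measurable Z) {r : ℝ} (hr : 0 < r)
    {C : ℝ≥0∞} (h : ∀ v : SGDM.E d, ‖v‖ ≤ r →
      ∫⁻ ω, ENNReal.ofReal (Real.exp (inner ℝ v (Z ω))) ∂Pr ≤ C) :
    ∫⁻ ω, ENNReal.ofReal (Real.exp (r * ‖Z ω‖ / 4)) ∂Pr ≤ 4 ^ d * C := by
  have hv0 : volume (Metric.ball (0 : SGDM.E d) r) ≠ 0 := (Metric.measure_ball_pos _ _ hr).ne'
  have hvt : volume (Metric.ball (0 : SGDM.E d) r) ≠ ⊤ := measure_ball_lt_top.ne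
  rw [← ENNReal.mul_le_mul_iff_left hv0 hvt, ← lintegral_mul_const' _ _ hvt]
  have hm : Measurable (Function.uncurry fun (ω : Ω) (v : SGDM.E d) =>
      ENNReal.ofReal (Real.exp (inner ℝ v (Z ω)))) := by
    have : Measurable fun p : Ω × SGDM.E d => inner ℝ p.2 (Z p.1) :=
      measurable_snd.inner (hZ.comp measurable_fst)
    exact ENNReal.measurable_ofReal.comp (Real.measurable_exp.comp this)
  calc ∫⁻ ω, ENNReal.ofReal (Real.exp (r * ‖Z ω‖ / 4)) * volume (Metric.ball (0 : SGDM.E d) r) ∂Pr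
      ≤ ∫⁻ ω, 4 ^ d * (∫⁻ v in Metric.ball (0 : SGDM.E d) r,
          ENNReal.ofReal (Real.exp (inner ℝ v (Z ω)))) ∂Pr :=
        lintegral_mono fun ω => exp_norm_mul_volume_le hr _
    _ = 4 ^ d * ∫⁻ v in Metric.ball (0 : SGDM.E d) r, (∫⁻ ω,
          ENNReal.ofReal (Real.exp (inner ℝ v (Z ω))) ∂Pr) := by
        rw [lintegral_const_mul' _ _ (by simp), lintegral_lintegral_swap hm.aemeasurable]
    _ ≤ 4 ^ d * ∫⁻ v in Metric.ball (0 : SGDM.E d) r, C := by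
        gcongr 4 ^ d * ?_
        refine setLIntegral_mono' measurableSet_ball fun v hv => h v ?_
        rw [Metric.mem_ball, dist_zero_right] at hv
        exact hv.le
    _ = _ := by rw [setLIntegral_const, mul_assoc]

end ballAverage

/-! ### Concentration of filtered adapted noise -/

section concentration

variable {S Ω : Type*} [MeasurableSpace S] [MeasurableSpace Ω] {P : Measure S}
  [IsProbabilityMeasure P] {Pr : Measure Ω} [IsProbabilityMeasure Pr] {d B : ℕ}
  {ξ : ℕ → Fin B → Ω → S}

/-- The average over a batch of the noise `ψ`, at the point `y`. -/
noncomputable def batchAverage (ψ : S → SGDM.E d → SGDM.E d) (η : Fin B → S) (y : SGDM.E d) :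
    SGDM.E d :=
  (1 / (B : ℝ)) • ∑ i, ψ (η i) y

/-- A tail bound for `∑_j W_{t-j} u_j`, where `u_j` is a batch average of centered sub-exponential
noise of scale `K_j`, evaluated at a point that depends on the past. The number `V` dominates
the standard deviation, up to a constant. -/
theorem measure_filtered_noise_le (hB : 1 ≤ B)
    (hlaw : ∀ t i, MeasurePreserving (ξ t i) Pr P)
    (hind : iIndepFun (fun p : ℕ × Fin B => ξ p.1 p.2) Pr) {x : ℕ → Ω → SGDM.E d}
    (hx : ∀ t, Measurable[pastAlgebra ξ t] (x t)) {ψ : ℕ → S → SGDM.E d → SGDM.E d}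
    (hψ : ∀ j, Measurable (Function.uncurry (ψ j)))
    (hψi : ∀ j y, Integrable (fun s => ψ j s y) P) (hψ0 : ∀ j y, ∫ s, ψ j s y ∂P = 0)
    {K : ℕ → ℝ} (hK : ∀ j, 0 < K j)
    (hexp : ∀ j y, ∀ v : SGDM.E d, ‖v‖ = 1 →
      ∫⁻ s, ENNReal.ofReal (Real.exp (|inner ℝ v (ψ j s y)| / K j)) ∂P ≤ 6)
    (W : ℕ → SGDM.E d →L[ℝ] SGDM.E d) (t : ℕ) {V : ℝ} (hV : 0 < V)
    (hvar : ∑ j ∈ Finset.Icc 1 t, ‖W (t - j)‖ ^ 2 * K j ^ 2 ≤ B * V ^ 2) (a : ℝ) :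
    Pr {ω | 8 * V * a ≤ ‖∑ j ∈ Finset.Icc 1 t,
        W (t - j) (batchAverage (ψ j) (fun i => ξ j i ω) (x j ω))‖} ≤
      ENNReal.ofReal (Real.exp (2 * d + 12 - a)) := by
  have hB' : (1 : ℝ) ≤ B := by exact_mod_cast hB
  have hB0 : (0 : ℝ) < B := by linarith
  have hξ : ∀ t i, Measurable (ξ t i) := fun t i => (hlaw t i).measurable
  have hxm : ∀ t, Measurable (x t) := fun t => (hx t).mono (pastAlgebra_le hξ t) le_rfl
  set Z : Ω → SGDM.E d := fun ω => ∑ j ∈ Finset.Icc 1 t,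
    W (t - j) (batchAverage (ψ j) (fun i => ξ j i ω) (x j ω)) with hZ
  have hZm : Measurable Z := by
    refine Finset.measurable_fun_sum _ fun j _ => (W (t - j)).measurable.comp ?_
    refine Measurable.const_smul (g := fun ω => ∑ i, ψ j (ξ j i ω) (x j ω)) ?_ (1 / (B : ℝ))
    exact Finset.measurable_fun_sum _ fun i _ => (hψ j).comp ((hξ j i).prodMk (hxm j))
  have hWK : ∀ j ∈ Finset.Icc 1 t, ‖W (t - j)‖ * K j ≤ B * V := by
    intro j hj
    have h1 := (Finset.single_le_sum (f := fun j => ‖W (t - j)‖ ^ 2 * K j ^ 2)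
      (fun j _ => by positivity) hj).trans hvar
    rw [← sq_le_sq₀ (mul_nonneg (norm_nonneg _) (hK j).le) (by positivity), mul_pow]
    refine h1.trans ?_
    rw [mul_pow]
    gcongr
    nlinarith
  -- the radius `1 / (2 V)` keeps every exponent `‖w_j‖ K_j` below `1 / 2`
  have hmgf : ∀ v : SGDM.E d, ‖v‖ ≤ 1 / (2 * V) →
      ∫⁻ ω, ENNReal.ofReal (Real.exp (inner ℝ v (Z ω))) ∂Pr ≤
        ENNReal.ofReal (Real.exp 12) := by
    intro v hv
    -- the scaled dual vectors, so that `⟨v, W_{t-j} u_j⟩ = ∑ᵢ ⟨w_j, ψ_j(ξ_{ji}, x_j)⟩`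
    set w : ℕ → SGDM.E d := fun j =>
      (1 / (B : ℝ)) • ContinuousLinearMap.adjoint (W (t - j)) v with hw
    have hwn : ∀ j, ‖w j‖ * B ≤ ‖W (t - j)‖ * (1 / (2 * V)) := by
      intro j
      have h1 := ContinuousLinearMap.le_of_opNorm_le _
        (le_of_eq (LinearIsometryEquiv.norm_map ContinuousLinearMap.adjoint (W (t - j)))) v
      rw [hw, norm_smul, Real.norm_of_nonneg (by positivity)]
      calc 1 / (B : ℝ) * ‖ContinuousLinearMap.adjoint (W (t - j)) v‖ * B
          = ‖ContinuousLinearMap.adjoint (W (t - j)) v‖ := by field_simp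
        _ ≤ ‖W (t - j)‖ * ‖v‖ := h1
        _ ≤ _ := by gcongr
    have hinner : ∀ ω, inner ℝ v (Z ω) =
        ∑ j ∈ Finset.Icc 1 t, ∑ i, inner ℝ (w j) (ψ j (ξ j i ω) (x j ω)) := by
      intro ω
      rw [hZ, inner_sum]
      refine Finset.sum_congr rfl fun j _ => ?_
      rw [← ContinuousLinearMap.adjoint_inner_left, batchAverage, inner_smul_right, inner_sum,
        Finset.mul_sum]
      refine Finset.sum_congr rfl fun i _ => ?_
      rw [hw, real_inner_smul_left]
    simp only [hinner]
    refine (lintegral_exp_adapted_sum_le hlaw hind hx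
      (φ := fun j s y => inner ℝ (w j) (ψ j s y)) (fun j => (hψ j).const_inner)
      (c := fun j => 48 * (‖w j‖ ^ 2 * K j ^ 2)) t fun j hj y => ?_).trans ?_
    · refine lintegral_exp_inner_le ((hψ j).comp measurable_prodMk_right) (hψi j y) (hψ0 j y)
        (hK j) (hexp j y) ?_
      have h1 := hWK j hj
      have h2 := hwn j
      have h3 : ‖w j‖ * K j * B ≤ 1 / 2 * B := by
        calc ‖w j‖ * K j * B = (‖w j‖ * B) * K j := by ring
          _ ≤ (‖W (t - j)‖ * (1 / (2 * V))) * K j := by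
              have := (hK j).le
              gcongr
          _ = (‖W (t - j)‖ * K j) * (1 / (2 * V)) := by ring
          _ ≤ B * V * (1 / (2 * V)) := by gcongr
          _ = 1 / 2 * B := by field_simp
      exact le_of_mul_le_mul_right h3 hB0
    · apply ENNReal.ofReal_le_ofReal
      apply Real.exp_le_exp.mpr
      calc (B : ℝ) * ∑ j ∈ Finset.Icc 1 t, 48 * (‖w j‖ ^ 2 * K j ^ 2)
          = 48 / B * ∑ j ∈ Finset.Icc 1 t, (‖w j‖ * B) ^ 2 * K j ^ 2 := by
            rw [Finset.mul_sum, Finset.mul_sum]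
            refine Finset.sum_congr rfl fun j _ => ?_
            field_simp
        _ ≤ 48 / B * ∑ j ∈ Finset.Icc 1 t, (‖W (t - j)‖ * (1 / (2 * V))) ^ 2 * K j ^ 2 := by
            gcongr ?_ * ?_
            exact Finset.sum_le_sum fun j _ => mul_le_mul_of_nonneg_right
              (pow_le_pow_left₀ (by positivity) (hwn j) 2) (by positivity)
        _ = 12 / (B * V ^ 2) * ∑ j ∈ Finset.Icc 1 t, ‖W (t - j)‖ ^ 2 * K j ^ 2 := by
            rw [Finset.mul_sum, Finset.mul_sum]
            refine Finset.sum_congr rfl fun j _ => ?_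
            field_simp
            ring
        _ ≤ 12 / (B * V ^ 2) * (B * V ^ 2) := by gcongr
        _ = 12 := by field_simp
  have hnorm := lintegral_exp_norm_le hZm (by positivity : 0 < 1 / (2 * V)) hmgf
  have hmarkov := meas_ge_le_lintegral_div (μ := Pr)
    (f := fun ω => ENNReal.ofReal (Real.exp (1 / (2 * V) * ‖Z ω‖ / 4)))
    (by fun_prop) (ε := ENNReal.ofReal (Real.exp a))
    (by simpa using Real.exp_pos a) ENNReal.ofReal_ne_top
  calc Pr {ω | 8 * V * a ≤ ‖Z ω‖}
      ≤ Pr {ω | ENNReal.ofReal (Real.exp a) ≤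
          ENNReal.ofReal (Real.exp (1 / (2 * V) * ‖Z ω‖ / 4))} := by
        refine measure_mono fun ω hω => ?_
        apply ENNReal.ofReal_le_ofReal
        apply Real.exp_le_exp.mpr
        have h1 : 8 * V * a ≤ ‖Z ω‖ := hω
        rw [show 1 / (2 * V) * ‖Z ω‖ / 4 = ‖Z ω‖ / (8 * V) by field_simp; ring,
          le_div_iff₀ (by positivity)]
        linarith
    _ ≤ (∫⁻ ω, ENNReal.ofReal (Real.exp (1 / (2 * V) * ‖Z ω‖ / 4)) ∂Pr) /
          ENNReal.ofReal (Real.exp a) := hmarkov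
    _ ≤ (4 ^ d * ENNReal.ofReal (Real.exp 12)) / ENNReal.ofReal (Real.exp a) := by gcongr
    _ ≤ _ := by
        rw [show (4 : ℝ≥0∞) = ENNReal.ofReal 4 by simp, ← ENNReal.ofReal_pow (by norm_num),
          ← ENNReal.ofReal_mul (by positivity), ← ENNReal.ofReal_div_of_pos (Real.exp_pos a)]
        apply ENNReal.ofReal_le_ofReal
        have h4 : (4 : ℝ) ≤ Real.exp 2 := by
          have := Real.quadratic_le_exp_of_nonneg (x := 2) (by norm_num)
          linarith
        have h5 : (4 : ℝ) ^ d ≤ Real.exp (2 * d) := by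
          rw [mul_comm, Real.exp_nat_mul]
          gcongr
        rw [Real.exp_sub, Real.exp_add]
        gcongr

end concentration

/-! ### The gradient noise of the algorithm -/

section noise

variable {d : ℕ} {S : Type*} [MeasurableSpace S] {P : Measure S} {f : S → SGDM.E d → ℝ}
  {xs : SGDM.E d}

open Classical in
/-- The deviation of the gradient of a sample from its mean, set to zero outside the ball of
radius `R` around `xs`. -/
noncomputable def truncatedNoise (P : Measure S) (f : S → SGDM.E d → ℝ) (xs : SGDM.E d) (R : ℝ)
    (s : S) (y : SGDM.E d) : SGDM.E d :=
  if ‖y - xs‖ ≤ R then gradient (f s) y - gradient (SGDM.meanLoss P f) y else 0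

lemma measurable_uncurry_gradient (hm : ∀ x, Measurable fun s => f s x)
    (hf : ∀ s, SGDM.TwiceDifferentiable (f s)) :
    Measurable fun p : S × SGDM.E d => gradient (f p.1) p.2 := by
  have h := measurable_uncurry_of_continuous_of_measurable
    (u := fun (x : SGDM.E d) (s : S) => gradient (f s) x) (fun s => (hf s).2.continuous)
    (measurable_gradient hm fun s => (hf s).1)
  exact h.comp measurable_swap

lemma measurable_truncatedNoise (hm : ∀ x, Measurable fun s => f s x)
    (hf : ∀ s, SGDM.TwiceDifferentiable (f s))
    (hmean : SGDM.TwiceDifferentiable (SGDM.meanLoss P f)) (R : ℝ) :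
    Measurable (Function.uncurry (truncatedNoise P f xs R)) := by
  refine Measurable.ite ?_ ((measurable_uncurry_gradient hm hf).sub
    (hmean.2.continuous.measurable.comp measurable_snd)) measurable_const
  exact measurableSet_le ((measurable_snd.sub_const xs).norm) measurable_const

variable [IsProbabilityMeasure P] {Λ : S → ℝ} {σ Lf : ℝ}

lemma integral_truncatedNoise
    (hi : ∀ y, Integrable (fun s => gradient (f s) y) P)
    (hmg : ∀ y, gradient (SGDM.meanLoss P f) y = ∫ s, gradient (f s) y ∂P) (R : ℝ)
    (y : SGDM.E d) : Integrable (fun s => truncatedNoise P f xs R s y) P ∧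
      ∫ s, truncatedNoise P f xs R s y ∂P = 0 := by
  by_cases h : ‖y - xs‖ ≤ R
  · simp only [truncatedNoise, if_pos h]
    refine ⟨(hi y).sub (integrable_const _), ?_⟩
    rw [integral_sub (hi y) (integrable_const _), hmg]
    simp
  · simp [truncatedNoise, if_neg h]

/-- By convexity of `exp`, the noise at `xs`, of scale `σ`, and the variation of the noise over
the ball, of scale `L_f R`, add up to noise of scale `σ + L_f R`. -/
lemma lintegral_exp_truncatedNoise_le (hm : ∀ x, Measurable fun s => f s x)
    (hf : ∀ s, SGDM.TwiceDifferentiable (f s))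
    (hi : ∀ y, Integrable (fun s => gradient (f s) y) P)
    (hmg : ∀ y, gradient (SGDM.meanLoss P f) y = ∫ s, gradient (f s) y ∂P)
    (hxs : gradient (SGDM.meanLoss P f) xs = 0)
    (hΛm : Measurable Λ) (hΛ0 : ∀ s, 0 ≤ Λ s) (hΛi : Integrable Λ P)
    (hlip : ∀ᵐ s ∂P, ∀ x, ‖gradient (f s) x - gradient (f s) xs‖ ≤ Λ s * ‖x - xs‖)
    (hσ : 0 < σ) (hLf : 0 < Lf)
    (hsub : ∀ v : SGDM.E d, ‖v‖ = 1 →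
      ∫⁻ s, ENNReal.ofReal (Real.exp (|inner ℝ v (gradient (f s) xs)| / σ)) ∂P ≤ 2)
    (hΛexp : ∫⁻ s, ENNReal.ofReal (Real.exp (Λ s / Lf)) ∂P ≤ 2) {R : ℝ} (hR : 0 ≤ R)
    (y v : SGDM.E d) (hv : ‖v‖ = 1) :
    ∫⁻ s, ENNReal.ofReal (Real.exp (|inner ℝ v (truncatedNoise P f xs R s y)| /
      (σ + Lf * R))) ∂P ≤ 6 := by
  by_cases hy : ‖y - xs‖ ≤ R
  swap
  · simp [truncatedNoise, if_neg hy]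
  simp only [truncatedNoise, if_pos hy]
  have hΛL : ∫ s, Λ s ∂P ≤ Lf := integral_le_of_lintegral_exp_le hΛm hΛ0 hLf hΛexp
  have hmeanle : ‖gradient (SGDM.meanLoss P f) y‖ ≤ Lf * R := by
    have h1 : gradient (SGDM.meanLoss P f) y =
        ∫ s, (gradient (f s) y - gradient (f s) xs) ∂P := by
      rw [integral_sub (hi y) (hi xs), ← hmg, ← hmg, hxs, sub_zero]
    rw [h1]
    calc ‖∫ s, (gradient (f s) y - gradient (f s) xs) ∂P‖
        ≤ ∫ s, Λ s * ‖y - xs‖ ∂P := by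
          refine norm_integral_le_of_norm_le (hΛi.mul_const _) ?_
          filter_upwards [hlip] with s hs using hs y
      _ = (∫ s, Λ s ∂P) * ‖y - xs‖ := integral_mul_const _ _
      _ ≤ Lf * R := by gcongr
  set D := σ + Lf * R with hD
  have hD0 : 0 < D := by positivity
  set p := σ / D with hp
  set q := Lf * R / D with hq
  have hp0 : 0 ≤ p := by positivity
  have hq0 : 0 ≤ q := by positivity
  have hpq : p + q = 1 := by rw [hp, hq, ← add_div, ← hD, div_self hD0.ne']
  have hpt : ∀ᵐ s ∂P, Real.exp (|inner ℝ v (gradient (f s) y -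
      gradient (SGDM.meanLoss P f) y)| / D) ≤
      p * Real.exp (|inner ℝ v (gradient (f s) xs)| / σ) +
        q * (Real.exp 1 * Real.exp (Λ s / Lf)) := by
    filter_upwards [hlip] with s hs
    have h1 : |inner ℝ v (gradient (f s) y - gradient (SGDM.meanLoss P f) y)| ≤
        |inner ℝ v (gradient (f s) xs)| + (Λ s * R + Lf * R) := by
      have e : gradient (f s) y - gradient (SGDM.meanLoss P f) y = gradient (f s) xs +
          ((gradient (f s) y - gradient (f s) xs) - gradient (SGDM.meanLoss P f) y) := by abel
      rw [e, inner_add_right]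
      refine (abs_add_le _ _).trans ?_
      gcongr
      refine (abs_real_inner_le_norm _ _).trans ?_
      rw [hv, one_mul]
      refine (norm_sub_le _ _).trans (add_le_add ((hs y).trans ?_) hmeanle)
      have := hΛ0 s
      gcongr
    have h2 : |inner ℝ v (gradient (f s) y - gradient (SGDM.meanLoss P f) y)| / D ≤
        p * (|inner ℝ v (gradient (f s) xs)| / σ) + q * (1 + Λ s / Lf) := by
      refine (div_le_div_of_nonneg_right h1 hD0.le).trans (le_of_eq ?_)
      rw [hp, hq]
      field_simp
      ring
    refine (Real.exp_le_exp.mpr h2).trans ?_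
    have h3 := convexOn_exp.2 (Set.mem_univ (|inner ℝ v (gradient (f s) xs)| / σ))
      (Set.mem_univ (1 + Λ s / Lf)) hp0 hq0 hpq
    simpa only [smul_eq_mul, Real.exp_add] using h3
  have hm1 : Measurable fun s => ENNReal.ofReal
      (Real.exp (|inner ℝ v (gradient (f s) xs)| / σ)) := by
    have : Measurable fun s => inner ℝ v (gradient (f s) xs) :=
      (measurable_gradient hm (fun s => (hf s).1) xs).const_inner
    fun_prop
  calc ∫⁻ s, ENNReal.ofReal (Real.exp (|inner ℝ v (gradient (f s) y -
        gradient (SGDM.meanLoss P f) y)| / D)) ∂P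
      ≤ ∫⁻ s, (ENNReal.ofReal p *
            ENNReal.ofReal (Real.exp (|inner ℝ v (gradient (f s) xs)| / σ)) +
          ENNReal.ofReal (q * Real.exp 1) * ENNReal.ofReal (Real.exp (Λ s / Lf))) ∂P := by
        refine lintegral_mono_ae ?_
        filter_upwards [hpt] with s hs
        rw [← ENNReal.ofReal_mul hp0, ← ENNReal.ofReal_mul (by positivity),
          ← ENNReal.ofReal_add (by positivity) (by positivity), mul_assoc]
        exact ENNReal.ofReal_le_ofReal hs
    _ = ENNReal.ofReal p *
            ∫⁻ s, ENNReal.ofReal (Real.exp (|inner ℝ v (gradient (f s) xs)| / σ)) ∂P +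
          ENNReal.ofReal (q * Real.exp 1) * ∫⁻ s, ENNReal.ofReal (Real.exp (Λ s / Lf)) ∂P := by
        rw [lintegral_add_left (hm1.const_mul _), lintegral_const_mul' _ _ ENNReal.ofReal_ne_top,
          lintegral_const_mul' _ _ ENNReal.ofReal_ne_top]
    _ ≤ ENNReal.ofReal p * 2 + ENNReal.ofReal (q * Real.exp 1) * 2 := by
        gcongr
        exact hsub v hv
    _ = ENNReal.ofReal ((p + q * Real.exp 1) * 2) := by
        rw [ENNReal.ofReal_mul (by positivity : 0 ≤ p + q * Real.exp 1),
          ENNReal.ofReal_add hp0 (by positivity), add_mul]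
        simp
    _ ≤ ENNReal.ofReal 6 := by
        apply ENNReal.ofReal_le_ofReal
        have := Real.exp_one_lt_three
        nlinarith
    _ = 6 := by simp

end noise

section iterates

variable {d B : ℕ} {S Ω : Type*} [MeasurableSpace S] {f : S → SGDM.E d → ℝ}

lemma measurable_iter_pastAlgebra (hm : ∀ x, Measurable fun s => f s x)
    (hf : ∀ s, SGDM.TwiceDifferentiable (f s)) (ξ : ℕ → Fin B → Ω → S) (α γ : ℝ)
    (x₁ : SGDM.E d) (t : ℕ) : Measurable[pastAlgebra ξ t]
      fun ω => SGDM.iter f α γ x₁ (fun k i => ξ k i ω) t := by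
  match t with
  | 0 => exact measurable_const
  | 1 => exact measurable_const
  | t + 2 =>
    have ih : Measurable[pastAlgebra ξ (t + 2)]
        fun ω => SGDM.iter f α γ x₁ (fun k i => ξ k i ω) (t + 1) :=
      (measurable_iter_pastAlgebra hm hf ξ α γ x₁ (t + 1)).mono
        (pastAlgebra_mono ξ (t + 1).le_succ) le_rfl
    simp only [SGDM.iter, gradient_batchLoss fun s => (hf s).1]
    have hg : Measurable[pastAlgebra ξ (t + 2)] fun ω => (1 / (B : ℝ)) •
        ∑ i, gradient (f (ξ (t + 1) i ω))
          (SGDM.iter f α γ x₁ (fun k i => ξ k i ω) (t + 1)).2 := by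
      refine Measurable.const_smul (g := fun ω => ∑ i, gradient (f (ξ (t + 1) i ω))
          (SGDM.iter f α γ x₁ (fun k i => ξ k i ω) (t + 1)).2) ?_ (1 / (B : ℝ))
      exact Finset.measurable_fun_sum _ fun i _ => (measurable_uncurry_gradient hm hf).comp
        ((measurable_sample_pastAlgebra ξ (Nat.lt_succ_self _) i).prodMk
          (measurable_snd.comp ih))
    have hmo := ((measurable_fst.comp ih).const_smul γ).add (hg.const_smul (1 - γ))
    exact hmo.prodMk ((measurable_snd.comp ih).sub (hmo.const_smul α))

end iterates

/-! ### Closing the nonlinear recursion -/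

section geometric

lemma sum_Icc_pow_sub_le {r : ℝ} (h0 : 0 ≤ r) (h1 : r < 1) (t : ℕ) :
    ∑ j ∈ Finset.Icc 1 t, r ^ (t - j) ≤ 1 / (1 - r) := by
  have hr : 0 < 1 - r := by linarith
  have key : (1 - r) * ∑ j ∈ Finset.Icc 1 t, r ^ (t - j) = 1 - r ^ t := by
    induction t with
    | zero => simp
    | succ t ih =>
      rw [sum_Icc_succ_conv (fun n _ => r ^ n) t]
      have : ∑ j ∈ Finset.Icc 1 t, r ^ (t - j + 1) = r * ∑ j ∈ Finset.Icc 1 t, r ^ (t - j) := by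
        rw [Finset.mul_sum]
        exact Finset.sum_congr rfl fun j _ => by ring
      rw [this]
      linear_combination r * ih
  rw [le_div_iff₀ hr, mul_comm, key]
  linarith [pow_nonneg h0 t]

variable {lam β δ : ℝ}

/-- For `β = λ^{1-δ}`, the sequences `λ^{t-j}` and `β^{j-1}` convolve to at most
`β^{t-1} / (δ (1 - λ))`, since `1 - λ^δ ≥ δ (1 - λ)` by concavity. -/
lemma sum_pow_mul_pow_le (hlam : 0 < lam) (hlam1 : lam < 1) (hδ : 0 < δ) (hδ1 : δ ≤ 1)
    (hβ : β = lam ^ (1 - δ)) (t : ℕ) :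
    ∑ j ∈ Finset.Icc 1 t, lam ^ (t - j) * β ^ (j - 1) ≤ β ^ t / (β * (δ * (1 - lam))) := by
  have hβ0 : 0 < β := by rw [hβ]; exact Real.rpow_pos_of_pos hlam _
  set μ := lam ^ δ with hμ
  have hμ0 : 0 ≤ μ := (Real.rpow_pos_of_pos hlam _).le
  have hlamβ : lam = β * μ := by
    rw [hβ, hμ, ← Real.rpow_add hlam]
    simp
  have hbern : δ * (1 - lam) ≤ 1 - μ := by
    have := rpow_one_add_le_one_add_mul_self (s := lam - 1) (by linarith) hδ.le hδ1
    rw [add_sub_cancel] at this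
    linarith
  have hpos : 0 < δ * (1 - lam) := mul_pos hδ (by linarith)
  calc ∑ j ∈ Finset.Icc 1 t, lam ^ (t - j) * β ^ (j - 1)
      = β ^ t / β * ∑ j ∈ Finset.Icc 1 t, μ ^ (t - j) := by
        rw [Finset.mul_sum]
        refine Finset.sum_congr rfl fun j hj => ?_
        obtain ⟨hj1, hj2⟩ := Finset.mem_Icc.mp hj
        have e : β ^ t = β ^ (t - j) * β ^ (j - 1) * β := by
          rw [← pow_add, ← pow_succ]
          congr 1
          omega
        rw [hlamβ, mul_pow, e]
        field_simp
    _ ≤ β ^ t / β * (1 / (δ * (1 - lam))) := by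
        have h1 := sum_Icc_pow_sub_le hμ0 (by linarith) t
        gcongr
        refine h1.trans ?_
        gcongr
    _ = _ := by rw [div_mul_div_comm, mul_one]

lemma sum_pow_mul_sq_le (hlam : 0 < lam) (hlam1 : lam < 1) (hδ : 0 < δ) (hδ1 : δ ≤ 1)
    (hβ : β = lam ^ (1 - δ)) {N Q : ℝ} (t : ℕ) :
    ∑ j ∈ Finset.Icc 1 t, lam ^ (t - j) * (N + Q * β ^ (j - 1)) ^ 2 ≤
      2 * N ^ 2 / (1 - lam) + 2 * Q ^ 2 * β ^ t / (β * (δ * (1 - lam))) := by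
  have hβ0 : 0 < β := by rw [hβ]; exact Real.rpow_pos_of_pos hlam _
  have hβ1 : β ≤ 1 := by rw [hβ]; exact Real.rpow_le_one hlam.le hlam1.le (by linarith)
  calc ∑ j ∈ Finset.Icc 1 t, lam ^ (t - j) * (N + Q * β ^ (j - 1)) ^ 2
      ≤ ∑ j ∈ Finset.Icc 1 t, (2 * N ^ 2 * lam ^ (t - j) +
          2 * Q ^ 2 * (lam ^ (t - j) * β ^ (j - 1))) := by
        refine Finset.sum_le_sum fun j _ => ?_
        have h1 : (N + Q * β ^ (j - 1)) ^ 2 ≤ 2 * N ^ 2 + 2 * Q ^ 2 * β ^ (j - 1) := by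
          have h2 : (β ^ (j - 1)) ^ 2 ≤ β ^ (j - 1) := by
            rw [sq]
            exact mul_le_of_le_one_left (by positivity) (pow_le_one₀ hβ0.le hβ1)
          have h3 : Q ^ 2 * (β ^ (j - 1)) ^ 2 ≤ Q ^ 2 * β ^ (j - 1) := by gcongr
          nlinarith [sq_nonneg (N - Q * β ^ (j - 1))]
        have h4 : 0 ≤ lam ^ (t - j) := by positivity
        calc lam ^ (t - j) * (N + Q * β ^ (j - 1)) ^ 2
            ≤ lam ^ (t - j) * (2 * N ^ 2 + 2 * Q ^ 2 * β ^ (j - 1)) := by gcongr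
          _ = _ := by ring
    _ = 2 * N ^ 2 * ∑ j ∈ Finset.Icc 1 t, lam ^ (t - j) +
          2 * Q ^ 2 * ∑ j ∈ Finset.Icc 1 t, lam ^ (t - j) * β ^ (j - 1) := by
        rw [Finset.sum_add_distrib, ← Finset.mul_sum, ← Finset.mul_sum]
    _ ≤ 2 * N ^ 2 * (1 / (1 - lam)) + 2 * Q ^ 2 * (β ^ t / (β * (δ * (1 - lam)))) := by
        have h1 := sum_Icc_pow_sub_le hlam.le hlam1 t
        have h2 := sum_pow_mul_pow_le hlam hlam1 hδ hδ1 hβ t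
        gcongr
    _ = _ := by ring

/-- The variance of the filtered noise, for noise of scale `s + g β^{j-1}` at time `j`. -/
lemma sum_sq_pow_mul_sq_le (hlam : 0 < lam) (hlam1 : lam < 1) (hδ : 0 < δ) (hδ1 : δ ≤ 1)
    (hβ : β = lam ^ (1 - δ)) {s g : ℝ} (hs : 0 ≤ s) (hg : 0 ≤ g) (t : ℕ) :
    ∑ j ∈ Finset.Icc 1 t, (lam ^ (t - j)) ^ 2 * (s + g * β ^ (j - 1)) ^ 2 ≤
      4 * (s / √(1 - lam) + g * β ^ t / (β * √δ * √(1 - lam))) ^ 2 := by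
  have hβ0 : 0 < β := by rw [hβ]; exact Real.rpow_pos_of_pos hlam _
  have hl : 0 < 1 - lam := by linarith
  have hsl := Real.sq_sqrt hl.le
  have hsδ := Real.sq_sqrt hδ.le
  have h1 := sum_Icc_pow_sub_le hlam.le hlam1 t
  have h2 := sum_pow_mul_pow_le hlam hlam1 hδ hδ1 hβ t
  have hle1 : ∀ n : ℕ, lam ^ n ≤ 1 := fun n => pow_le_one₀ hlam.le hlam1.le
  calc ∑ j ∈ Finset.Icc 1 t, (lam ^ (t - j)) ^ 2 * (s + g * β ^ (j - 1)) ^ 2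
      ≤ ∑ j ∈ Finset.Icc 1 t, (2 * s ^ 2 * lam ^ (t - j) +
          2 * g ^ 2 * (β ^ t / β) * (lam ^ (t - j) * β ^ (j - 1))) := by
        refine Finset.sum_le_sum fun j hj => ?_
        obtain ⟨hj1, hj2⟩ := Finset.mem_Icc.mp hj
        set a := lam ^ (t - j) with ha
        have ha0 : 0 ≤ a := by positivity
        have ha2 : a ^ 2 ≤ a := by nlinarith [hle1 (t - j)]
        have haβ : a * β ^ (j - 1) ≤ β ^ t / β := by
          have e : β ^ t / β = β ^ (t - j) * β ^ (j - 1) := by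
            rw [div_eq_iff hβ0.ne', ← pow_add, ← pow_succ]
            congr 1
            omega
          rw [e, ha]
          have : lam ≤ β := by
            rw [hβ]
            exact Real.self_le_rpow_of_le_one hlam.le hlam1.le (by linarith)
          gcongr
        have h3 : a ^ 2 * s ^ 2 ≤ a * s ^ 2 := by gcongr
        have h4 : g ^ 2 * (a * β ^ (j - 1)) * (a * β ^ (j - 1)) ≤
            g ^ 2 * (β ^ t / β) * (a * β ^ (j - 1)) := by gcongr
        have h5 : a ^ 2 * (s + g * β ^ (j - 1)) ^ 2 ≤ 2 * (a ^ 2 * s ^ 2) +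
            2 * (g ^ 2 * (a * β ^ (j - 1)) * (a * β ^ (j - 1))) := by
          nlinarith [sq_nonneg (a * (s - g * β ^ (j - 1)))]
        linarith
    _ = 2 * s ^ 2 * ∑ j ∈ Finset.Icc 1 t, lam ^ (t - j) +
          2 * g ^ 2 * (β ^ t / β) * ∑ j ∈ Finset.Icc 1 t, lam ^ (t - j) * β ^ (j - 1) := by
        rw [Finset.sum_add_distrib, ← Finset.mul_sum, ← Finset.mul_sum]
    _ ≤ 2 * s ^ 2 * (1 / (1 - lam)) +
          2 * g ^ 2 * (β ^ t / β) * (β ^ t / (β * (δ * (1 - lam)))) := by gcongr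
    _ = 2 * (s / √(1 - lam)) ^ 2 + 2 * (g * β ^ t / (β * √δ * √(1 - lam))) ^ 2 := by
        rw [div_pow, div_pow, mul_pow (β * √δ), mul_pow β, hsl, hsδ]
        field_simp
    _ ≤ _ := by
        have h3 : 0 ≤ s / √(1 - lam) := by positivity
        have h4 : 0 ≤ g * β ^ t / (β * √δ * √(1 - lam)) := by positivity
        nlinarith [mul_nonneg h3 h4]

end geometric

/-- The bookkeeping of the error terms: noise at the minimizer, noise growing with the distance,
the quadratic remainder and the initial displacement together stay below the tracking radius
`N + Q β^t`. -/
lemma error_budget {lam β δ M ℓ Lf Lbar α σ b s y N Q u v : ℝ}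
    (hlam1 : lam < 1) (hβ0 : 0 < β) (hβ1 : β ≤ 1) (hδ : 0 < δ) (hδ1 : δ ≤ 1) (hM : 0 < M)
    (hℓ : 0 ≤ ℓ) (hLf : 0 < Lf) (hLbar : 0 < Lbar) (hα : 0 < α) (hσ : 0 < σ) (hb : 0 < b)
    (hs : 0 < s) (hy : 0 ≤ y) (huv : u ≤ v) (hv : 0 ≤ v)
    (hN : N = 3 * √2 * 64 * ℓ * M / (b * s) * α * σ) (hQ : Q = 3 * M * y)
    (hcond : 6 * √2 * 64 * ℓ * M * (2 * Lf / (β * √δ * s) +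
      3 * Lbar * M * α * σ / ((1 - lam) * s)) * α ≤ b)
    (hinit : y ≤ δ * (1 - lam) * β / (36 * M ^ 2 * α * Lbar)) :
    M / 2 * u * y + α * (64 * ℓ * (M / b * ((σ + Lf * N) / s + Lf * Q * v / (β * √δ * s))) +
      M * Lbar * (2 * N ^ 2 / (1 - lam) + 2 * Q ^ 2 * v / (β * (δ * (1 - lam))))) ≤
      N + Q * v := by
  have hl : 0 < 1 - lam := by linarith
  have hsδ : 0 < √δ := Real.sqrt_pos.mpr hδ
  have hsδ1 : √δ ≤ 1 := Real.sqrt_le_one.mpr hδ1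
  have hr2 : (1 : ℝ) ≤ √2 := Real.one_le_sqrt.mpr (by norm_num)
  have hr2' : (4 : ℝ) / 3 ≤ √2 := Real.le_sqrt_of_sq_le (by norm_num)
  set X := α * 64 * ℓ * M / b with hX
  have hX0 : 0 ≤ X := by positivity
  set q := X * Lf / (β * √δ * s) with hq
  have hq0 : 0 ≤ q := by positivity
  have hNX : N = 3 * √2 * (X * σ / s) := by rw [hN, hX]; field_simp
  have hN0 : 0 ≤ N := by rw [hNX]; positivity
  have hQ0 : 0 ≤ Q := by rw [hQ]; positivity
  set ν := N * (Lbar * M * α / (1 - lam)) with hν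
  have hν0 : 0 ≤ ν := by positivity
  have hc : 12 * √2 * q + 6 * ν ≤ 1 := by
    have e : 6 * √2 * 64 * ℓ * M * (2 * Lf / (β * √δ * s) +
        3 * Lbar * M * α * σ / ((1 - lam) * s)) * α = (12 * √2 * q + 6 * ν) * b := by
      rw [hν, hNX, hq, hX]
      field_simp
      ring
    rw [e] at hcond
    exact le_of_mul_le_mul_right (by linarith) hb
  have hq2 : q ≤ √2 * q := le_mul_of_one_le_left hq0 hr2
  have hq1 : q ≤ 1 / 12 := by linarith
  have hν1 : ν ≤ 1 / 6 := by linarith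
  have hinit' : M * Lbar * α * Q / (β * (δ * (1 - lam))) ≤ 1 / 12 := by
    rw [le_div_iff₀ (by positivity)] at hinit
    rw [div_le_iff₀ (by positivity), hQ]
    linarith
  have t1 : α * (64 * ℓ * (M / b * (σ / s))) ≤ N / 4 := by
    have e : α * (64 * ℓ * (M / b * (σ / s))) = X * σ / s := by rw [hX]; field_simp
    rw [e, hNX]
    have h0 : 0 ≤ X * σ / s := by positivity
    have := mul_le_mul_of_nonneg_right hr2' h0
    linarith
  have t2 : α * (64 * ℓ * (M / b * (Lf * N / s))) ≤ N / 12 := by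
    have e : α * (64 * ℓ * (M / b * (Lf * N / s))) = (q * (β * √δ)) * N := by
      rw [hq, hX]; field_simp
    have h1 : q * (β * √δ) ≤ q * 1 := by
      gcongr
      exact mul_le_one₀ hβ1 hsδ.le hsδ1
    rw [e]
    have := mul_le_mul_of_nonneg_right (h1.trans ((mul_one q).le.trans hq1)) hN0
    linarith
  have t3 : α * (64 * ℓ * (M / b * (Lf * Q * v / (β * √δ * s)))) ≤ Q * v / 12 := by
    have e : α * (64 * ℓ * (M / b * (Lf * Q * v / (β * √δ * s)))) = q * (Q * v) := by
      rw [hq, hX]; field_simp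
    have : 0 ≤ Q * v := by positivity
    rw [e]
    have := mul_le_mul_of_nonneg_right hq1 this
    linarith
  have t4 : α * (M * Lbar * (2 * N ^ 2 / (1 - lam))) ≤ N / 3 := by
    have e : α * (M * Lbar * (2 * N ^ 2 / (1 - lam))) = 2 * ν * N := by
      rw [hν]; field_simp
    rw [e]
    have := mul_le_mul_of_nonneg_right hν1 hN0
    linarith
  have t5 : α * (M * Lbar * (2 * Q ^ 2 * v / (β * (δ * (1 - lam))))) ≤ Q * v / 6 := by
    have e : α * (M * Lbar * (2 * Q ^ 2 * v / (β * (δ * (1 - lam))))) =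
        2 * (M * Lbar * α * Q / (β * (δ * (1 - lam)))) * (Q * v) := by
      field_simp
    have : 0 ≤ Q * v := by positivity
    rw [e]
    have := mul_le_mul_of_nonneg_right hinit' this
    linarith
  have t6 : M / 2 * u * y ≤ Q * v / 6 := by
    rw [hQ]
    have : M * y * u ≤ M * y * v := by gcongr
    linarith
  have e : M / 2 * u * y +
      α * (64 * ℓ * (M / b * ((σ + Lf * N) / s + Lf * Q * v / (β * √δ * s))) +
      M * Lbar * (2 * N ^ 2 / (1 - lam) + 2 * Q ^ 2 * v / (β * (δ * (1 - lam))))) =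
      M / 2 * u * y + α * (64 * ℓ * (M / b * (σ / s))) + α * (64 * ℓ * (M / b * (Lf * N / s))) +
        α * (64 * ℓ * (M / b * (Lf * Q * v / (β * √δ * s)))) +
        α * (M * Lbar * (2 * N ^ 2 / (1 - lam))) +
        α * (M * Lbar * (2 * Q ^ 2 * v / (β * (δ * (1 - lam))))) := by
    ring
  have : 0 ≤ Q * v := by positivity
  rw [e]
  linarith

/-- A self-consistent bound propagates along the iteration. -/
lemma tracking_induction {T : ℕ} {Y Z R : ℕ → ℝ} (h1 : Y 1 ≤ R 0)
    (hYZ : ∀ t, Y (t + 1) ≤ Z t)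
    (hstep : ∀ t ∈ Finset.Icc 1 T, (∀ j ∈ Finset.Icc 1 t, Y j ≤ R (j - 1)) → Z t ≤ R t) :
    ∀ t ∈ Finset.Icc 1 T, Z t ≤ R t := by
  intro t
  induction t using Nat.strong_induction_on with
  | _ t ih =>
    intro ht
    refine hstep t ht fun j hj => ?_
    obtain ⟨hj1, hj2⟩ := Finset.mem_Icc.mp hj
    rcases Nat.lt_or_ge 1 j with h | h
    · obtain ⟨k, rfl⟩ : ∃ k, j = k + 1 := ⟨j - 1, by omega⟩
      have := (Finset.mem_Icc.mp ht).2
      exact (hYZ k).trans (ih k (by omega) (Finset.mem_Icc.mpr ⟨by omega, by omega⟩))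
    · obtain rfl : j = 1 := by omega
      exact h1

/-- One step of the tracking argument for the filtered sums: the Duhamel error, the noise and the
quadratic remainder are controlled separately for both components. -/
lemma sqrt_norm_sq_add_norm_sq_le {d : ℕ} {W₁ W₂ : ℕ → SGDM.E d →L[ℝ] SGDM.E d}
    {M lam α C Lbar y₁ G₁ G₂ : ℝ} (hM : 0 ≤ M) (hlam : 0 ≤ lam) (hα : 0 ≤ α)
    (hW₁ : ∀ n, ‖W₁ n‖ ≤ M / 2 * lam ^ n) (hW₂ : ∀ n, ‖W₂ n‖ ≤ M / 2 * lam ^ n)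
    {a z : SGDM.E d} {e u r : ℕ → SGDM.E d} {R : ℕ → ℝ} {t : ℕ}
    (ha : ‖a + α • ∑ j ∈ Finset.Icc 1 t, W₁ (t - j) (e j)‖ ≤ M / 4 * lam ^ t * y₁)
    (hz : ‖z + α • ∑ j ∈ Finset.Icc 1 t, W₂ (t - j) (e j)‖ ≤ M / 4 * lam ^ t * y₁)
    (he : ∀ j ∈ Finset.Icc 1 t, e j = u j + r j)
    (hr : ∀ j ∈ Finset.Icc 1 t, ‖r j‖ ≤ Lbar * R j)
    (hu₁ : ‖∑ j ∈ Finset.Icc 1 t, W₁ (t - j) (u j)‖ ≤ G₁)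
    (hu₂ : ‖∑ j ∈ Finset.Icc 1 t, W₂ (t - j) (u j)‖ ≤ G₂)
    (hC : ∑ j ∈ Finset.Icc 1 t, lam ^ (t - j) * R j ≤ C) (hLbar : 0 ≤ Lbar) :
    √(‖a‖ ^ 2 + ‖z‖ ^ 2) ≤ M / 2 * lam ^ t * y₁ + α * (G₁ + G₂ + M * Lbar * C) := by
  have key : ∀ (W : ℕ → SGDM.E d →L[ℝ] SGDM.E d) (x : SGDM.E d) (G : ℝ),
      (∀ n, ‖W n‖ ≤ M / 2 * lam ^ n) →
      ‖x + α • ∑ j ∈ Finset.Icc 1 t, W (t - j) (e j)‖ ≤ M / 4 * lam ^ t * y₁ →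
      ‖∑ j ∈ Finset.Icc 1 t, W (t - j) (u j)‖ ≤ G →
      ‖x‖ ≤ M / 4 * lam ^ t * y₁ + α * (G + M / 2 * Lbar * C) := by
    intro W x G hW hx hG
    have h1 : ∑ j ∈ Finset.Icc 1 t, W (t - j) (e j) =
        ∑ j ∈ Finset.Icc 1 t, W (t - j) (u j) + ∑ j ∈ Finset.Icc 1 t, W (t - j) (r j) := by
      rw [← Finset.sum_add_distrib]
      exact Finset.sum_congr rfl fun j hj => by rw [he j hj, map_add]
    have h2 : ‖∑ j ∈ Finset.Icc 1 t, W (t - j) (r j)‖ ≤ M / 2 * Lbar * C := by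
      calc ‖∑ j ∈ Finset.Icc 1 t, W (t - j) (r j)‖
          ≤ ∑ j ∈ Finset.Icc 1 t, M / 2 * Lbar * (lam ^ (t - j) * R j) := by
            refine norm_sum_le_of_le _ fun j hj => ?_
            calc ‖W (t - j) (r j)‖ ≤ M / 2 * lam ^ (t - j) * ‖r j‖ :=
                  ContinuousLinearMap.le_of_opNorm_le _ (hW _) _
              _ ≤ M / 2 * lam ^ (t - j) * (Lbar * R j) := by
                  gcongr
                  exact hr j hj
              _ = _ := by ring
        _ = M / 2 * Lbar * ∑ j ∈ Finset.Icc 1 t, lam ^ (t - j) * R j := by rw [Finset.mul_sum]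
        _ ≤ _ := by gcongr
    calc ‖x‖ = ‖(x + α • ∑ j ∈ Finset.Icc 1 t, W (t - j) (e j)) -
          α • ∑ j ∈ Finset.Icc 1 t, W (t - j) (e j)‖ := by rw [add_sub_cancel_right]
      _ ≤ _ + ‖α • ∑ j ∈ Finset.Icc 1 t, W (t - j) (e j)‖ := norm_sub_le _ _
      _ ≤ M / 4 * lam ^ t * y₁ + α * (G + M / 2 * Lbar * C) := by
          have h3 := (norm_add_le (∑ j ∈ Finset.Icc 1 t, W (t - j) (u j))
            (∑ j ∈ Finset.Icc 1 t, W (t - j) (r j))).trans (add_le_add hG h2)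
          refine add_le_add hx ?_
          rw [norm_smul, Real.norm_of_nonneg hα, h1]
          gcongr
  have h1 := key W₁ a G₁ hW₁ ha hu₁
  have h2 := key W₂ z G₂ hW₂ hz hu₂
  calc √(‖a‖ ^ 2 + ‖z‖ ^ 2) ≤ ‖a‖ + ‖z‖ := by
        rw [Real.sqrt_le_left (by positivity)]
        nlinarith [norm_nonneg a, norm_nonneg z]
    _ ≤ _ := by linarith

/-! ### The tracking bound with high probability -/

theorem mainTheorem3 :
    ∃ c : ℝ, 0 < c ∧
      ∀ (d : ℕ) (S : Type*) [MeasurableSpace S] (P : Measure S) [IsProbabilityMeasure P]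
        (f : S → SGDM.E d → ℝ) (xs : SGDM.E d)
        -- the loss is a random variable with a finite mean, and `xs` minimizes the mean
        (_hmeas : ∀ x, Measurable fun s => f s x)
        (_hint : ∀ x, Integrable (fun s => f s x) P)
        (_hmin : ∀ x, SGDM.meanLoss P f xs ≤ SGDM.meanLoss P f x)
        -- twice differentiable losses, positive definite mean Hessian at the minimizer
        (_hdiff : ∀ s, SGDM.TwiceDifferentiable (f s))
        (_hpos : 0 < SGDM.minEig (SGDM.meanHessian P f xs))
        -- Lipschitz condition at `xs` on the Hessian of the mean loss
        (Lbar : ℝ) (_hLbar : 0 < Lbar)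
        (_hdiffMean : SGDM.TwiceDifferentiable (SGDM.meanLoss P f))
        (_hlip : ∀ x, ‖SGDM.op (SGDM.hessian (SGDM.meanLoss P f) x
            - SGDM.hessian (SGDM.meanLoss P f) xs)‖ ≤ Lbar * ‖x - xs‖)
        -- sub-exponential gradient at `xs` and sub-exponential smoothness constant
        (σ Lf : ℝ) (_hσ : 0 < σ) (_hLf : 0 < Lf)
        (_hsubexp : ∀ v : SGDM.E d, ‖v‖ = 1 →
          ∫⁻ s, ENNReal.ofReal (Real.exp (|inner ℝ v (gradient (f s) xs)| / σ)) ∂P ≤ 2)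
        (_hsmooth :
          ∫⁻ s, EReal.exp ((SGDM.gradLip (f s) xs / ENNReal.ofReal Lf : ℝ≥0∞) : EReal) ∂P ≤ 2)
        -- i.i.d. samples `ξ t i` with law `P`, for `t = 1, 2, …` and `i` in a batch of size `B`
        (Ω : Type*) [MeasurableSpace Ω] (Pr : Measure Ω) [IsProbabilityMeasure Pr]
        (B : ℕ) (_hB : 1 ≤ B) (ξ : ℕ → Fin B → Ω → S)
        (_hlaw : ∀ t i, MeasurePreserving (ξ t i) Pr P)
        (_hindep : iIndepFun (fun p : ℕ × Fin B => ξ p.1 p.2) Pr)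
        -- momentum, learning rate, horizon and initialization
        (γ α δ : ℝ) (T : ℕ) (x₁ : SGDM.E d)
        (_hγ : 0 ≤ γ ∧ γ < 1) (_hα : 0 < α) (_hδ : 0 < δ ∧ δ ≤ 1) (_hT : 1 ≤ T),
        let A := SGDM.meanHessian P f xs
        let lam := SGDM.rate A α γ
        let M := SGDM.bigM A α γ
        let ℓ := 2 * Real.log T + 4 * d
        0 < SGDM.gap A α γ →
        α * SGDM.maxEig A < 2 * (1 + γ) / (1 - γ) →
        6 * Real.sqrt 2 * c * ℓ * M *
            (2 * Lf / (lam ^ (1 - δ) * Real.sqrt δ * (1 - lam) ^ (1 / 2 : ℝ))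
              + 3 * Lbar * M * α * σ / (1 - lam) ^ (3 / 2 : ℝ)) * α ≤ Real.sqrt B →
        ‖x₁ - xs‖ ≤ δ * (1 - lam) * lam ^ (1 - δ) / (36 * M ^ 2 * α * Lbar) →
        ENNReal.ofReal (1 - 2 / (T : ℝ)) ≤
          Pr {ω | ∀ t ∈ Finset.Icc 1 T,
            let x : ℕ → SGDM.E d := fun j =>
              (SGDM.iter f α γ x₁ (fun k i => ξ k i ω) j).2
            Real.sqrt (‖SGDM.mTildeSucc A γ xs x t‖ ^ 2 + ‖x (t + 1) - xs‖ ^ 2) ≤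
              3 * Real.sqrt 2 * c * ℓ * M / Real.sqrt (B * (1 - lam)) * α * σ
                + 3 * M * ‖x₁ - xs‖ * lam ^ ((1 - δ) * t)} := by
  -- two components, each deviating by at most `8 V (4 ℓ) = 32 ℓ V`
  refine ⟨64, by norm_num, ?_⟩
  intro d S _ P _ f xs hm hint hmin hf hpos Lbar hLbar hmean hlipH σ Lf hσ hLf hsub hsmooth Ω _ Pr _
    B hB ξ hlaw hind γ α δ T x₁ ⟨hγ, hγ1⟩ hα ⟨hδ, hδ1⟩ hT A lam M ℓ hgap hαL hcond hinit
  -- the population gradient and the mean Hessian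
  obtain ⟨Λ, hΛm, hΛ0, hlip, hΛexp⟩ := exists_measurable_smoothness hm hf hLf hsmooth
  have hΛi : Integrable Λ P := by
    refine integrable_of_lintegral_exp_le hΛm.aestronglyMeasurable hLf
      (by simp : (2 : ℝ≥0∞) ≠ ⊤) ?_
    simpa [abs_of_nonneg (hΛ0 _)] using hΛexp
  have hgxs : Integrable (fun s => gradient (f s) xs) P := integrable_of_inner fun v hv =>
    integrable_of_lintegral_exp_le (((measurable_gradient hm (fun s => (hf s).1)
      xs).const_inner).aestronglyMeasurable) hσ (by simp : (2 : ℝ≥0∞) ≠ ⊤) (hsub v hv)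
  have hgi := integrable_gradient hm hf hΛi hlip hgxs
  have hmg := gradient_meanLoss hm hint hf hΛi hΛ0 hlip hgxs
  have hxs0 : gradient (SGDM.meanLoss P f) xs = 0 := by
    have h : IsLocalMin (SGDM.meanLoss P f) xs := Filter.Eventually.of_forall hmin
    refine ext_inner_left ℝ fun v => ?_
    rw [inner_gradient_eq_fderiv, h.fderiv_eq_zero]
    simp
  have hAeq : A = SGDM.hessian (SGDM.meanLoss P f) xs :=
    meanHessian_eq_hessian_meanLoss hm hint hf hΛi hΛ0 hlip hgxs hmean
  have hA : A.IsHermitian := hAeq ▸ isHermitian_hessian hmean xs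
  -- the spectrum of the mean Hessian and the contraction rate
  -- in dimension zero the spectrum is empty and `minEig` would be `sInf ∅ = 0`
  have hd : 0 < d := by
    rcases Nat.eq_zero_or_pos d with rfl | h
    · simp [SGDM.minEig, spectrum.of_subsingleton] at hpos
    · exact h
  have hfin : (spectrum ℝ A).Finite := A.finite_real_spectrum
  have hmem : ∀ k, hA.eigenvalues k ∈ spectrum ℝ A := fun k =>
    hA.spectrum_real_eq_range_eigenvalues ▸ Set.mem_range_self k
  have hκ : ∀ k, 0 < hA.eigenvalues k := fun k =>
    hpos.trans_le (csInf_le hfin.bddBelow (hmem k))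
  have hκL : ∀ k, hA.eigenvalues k ≤ SGDM.maxEig A := fun k => le_csSup hfin.bddAbove (hmem k)
  have hlam1 : lam < 1 := rate_lt_one hA hγ1 hα hκ fun k =>
    lt_of_le_of_lt (by have := hκL k; gcongr) hαL
  have hlam0 : 0 < lam := rate_pos hA hγ1 hκ hgap hd
  have hL0 : 0 < SGDM.maxEig A := (hκ ⟨0, hd⟩).trans_le (hκL _)
  have hg : 0 < 1 - γ := by linarith
  have hM : 0 < M := by
    have : 0 < √(SGDM.gap A α γ) := Real.sqrt_pos.mpr hgap
    simp only [M, SGDM.bigM]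
    positivity
  obtain ⟨W₁, W₂, hW₁, hW₂, hsol⟩ :=
    exists_impulse_response hA hγ hγ1 hα hκ hlam1 hgap hlam0.le hM.le
  -- the tracking radius
  set β := lam ^ (1 - δ) with hβ
  have hβ0 : 0 < β := Real.rpow_pos_of_pos hlam0 _
  have hβ1 : β ≤ 1 := Real.rpow_le_one hlam0.le hlam1.le (by linarith)
  have hl : 0 < 1 - lam := by linarith
  set s := √(1 - lam) with hs
  have hs0 : 0 < s := Real.sqrt_pos.mpr hl
  have hB0 : (0 : ℝ) < B := by exact_mod_cast hB
  set b := √(B : ℝ) with hb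
  have hb0 : 0 < b := Real.sqrt_pos.mpr hB0
  have hlogT : 0 ≤ Real.log T := Real.log_nonneg (by exact_mod_cast hT)
  have hd1 : (1 : ℝ) ≤ d := by exact_mod_cast hd
  have hℓ : 0 ≤ ℓ := by simp only [ℓ]; positivity
  set y₁ := ‖x₁ - xs‖ with hy₁
  set N := 3 * √2 * 64 * ℓ * M / (b * s) * α * σ with hN
  set Q := 3 * M * y₁ with hQ
  have hN0 : 0 ≤ N := by positivity
  have hQ0 : 0 ≤ Q := by positivity
  set R : ℕ → ℝ := fun t => N + Q * β ^ t with hR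
  have hR0 : ∀ t, 0 ≤ R t := fun t => by positivity
  set K : ℕ → ℝ := fun j => σ + Lf * R (j - 1) with hK
  have hK0 : ∀ j, 0 < K j := fun j => by have := hR0 (j - 1); positivity
  set V : ℕ → ℝ := fun t => M / b * ((σ + Lf * N) / s + Lf * Q * β ^ t / (β * √δ * s)) with hV
  have hV0 : ∀ t, 0 < V t := fun t => by
    have : 0 < √δ := Real.sqrt_pos.mpr hδ
    positivity
  have hvar : ∀ W : ℕ → SGDM.E d →L[ℝ] SGDM.E d, (∀ n, ‖W n‖ ≤ M / 2 * lam ^ n) → ∀ t,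
      ∑ j ∈ Finset.Icc 1 t, ‖W (t - j)‖ ^ 2 * K j ^ 2 ≤ B * V t ^ 2 := by
    intro W hW t
    have h := sum_sq_pow_mul_sq_le hlam0 hlam1 hδ hδ1 hβ (s := σ + Lf * N) (g := Lf * Q)
      (by positivity) (by positivity) t
    calc ∑ j ∈ Finset.Icc 1 t, ‖W (t - j)‖ ^ 2 * K j ^ 2
        ≤ ∑ j ∈ Finset.Icc 1 t, (M / 2 * lam ^ (t - j)) ^ 2 * K j ^ 2 :=
          Finset.sum_le_sum fun j _ => mul_le_mul_of_nonneg_right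
            (pow_le_pow_left₀ (norm_nonneg _) (hW _) 2) (sq_nonneg _)
      _ = (M / 2) ^ 2 * ∑ j ∈ Finset.Icc 1 t, (lam ^ (t - j)) ^ 2 *
            (σ + Lf * N + Lf * Q * β ^ (j - 1)) ^ 2 := by
          rw [Finset.mul_sum]
          refine Finset.sum_congr rfl fun j _ => ?_
          simp only [hK, hR]
          ring
      _ ≤ (M / 2) ^ 2 * (4 * ((σ + Lf * N) / s + Lf * Q * β ^ t / (β * √δ * s)) ^ 2) := by
          gcongr
      _ = _ := by
          have hbB : b ^ 2 = B := Real.sq_sqrt hB0.le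
          simp only [hV]
          rw [← hbB]
          field_simp
          norm_num
  -- the iterates, the truncated noise and the events on which it is too large
  set it : ℕ → Ω → SGDM.E d × SGDM.E d := fun t ω =>
    SGDM.iter f α γ x₁ (fun k i => ξ k i ω) t with hit
  have hitm : ∀ t, Measurable[pastAlgebra ξ t] (it t) :=
    measurable_iter_pastAlgebra hm hf ξ α γ x₁
  set ψ : ℕ → S → SGDM.E d → SGDM.E d := fun j => truncatedNoise P f xs (R (j - 1)) with hψ
  set u : ℕ → Ω → SGDM.E d := fun j ω =>
    batchAverage (ψ j) (fun i => ξ j i ω) (it j ω).2 with hu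
  have htail : ∀ W : ℕ → SGDM.E d →L[ℝ] SGDM.E d, (∀ n, ‖W n‖ ≤ M / 2 * lam ^ n) → ∀ t,
      Pr {ω | 8 * V t * (4 * ℓ) ≤ ‖∑ j ∈ Finset.Icc 1 t, W (t - j) (u j ω)‖} ≤
        ENNReal.ofReal (1 / (T : ℝ) ^ 2) := by
    intro W hW t
    refine (measure_filtered_noise_le hB hlaw hind (fun t => measurable_snd.comp (hitm t))
      (fun j => measurable_truncatedNoise hm hf hmean _)
      (fun j y => (integral_truncatedNoise hgi hmg _ y).1)
      (fun j y => (integral_truncatedNoise hgi hmg _ y).2) hK0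
      (fun j y v hv => lintegral_exp_truncatedNoise_le hm hf hgi hmg hxs0 hΛm hΛ0 hΛi hlip hσ hLf
        hsub hΛexp (hR0 _) y v hv) W t (hV0 t) (hvar W hW t) (4 * ℓ)).trans ?_
    -- `2 d + 12 - 4 ℓ ≤ -2 log T`, because `ℓ = 2 log T + 4 d` and `d ≥ 1`
    apply ENNReal.ofReal_le_ofReal
    have hT0 : (0 : ℝ) < T := by exact_mod_cast hT
    rw [one_div, ← Real.exp_log (by positivity : 0 < ((T : ℝ) ^ 2)⁻¹), Real.log_inv, Real.log_pow]
    apply Real.exp_le_exp.mpr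
    simp only [ℓ]
    push_cast
    linarith
  -- outside these events the tracking bound propagates
  have hgood : ∀ ω, (∀ t ∈ Finset.Icc 1 T,
      ‖∑ j ∈ Finset.Icc 1 t, W₁ (t - j) (u j ω)‖ ≤ 8 * V t * (4 * ℓ) ∧
      ‖∑ j ∈ Finset.Icc 1 t, W₂ (t - j) (u j ω)‖ ≤ 8 * V t * (4 * ℓ)) →
      ∀ t ∈ Finset.Icc 1 T,
        √(‖SGDM.mTildeSucc A γ xs (fun j => (it j ω).2) t‖ ^ 2 +
          ‖(it (t + 1) ω).2 - xs‖ ^ 2) ≤ R t := by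
    intro ω hω
    set y : ℕ → SGDM.E d := fun j => (it j ω).2 - xs with hy
    set e : ℕ → SGDM.E d := fun j =>
      gradient (SGDM.batchLoss f (fun i => ξ j i ω)) (it j ω).2 - SGDM.op A (y j) with he
    have hsolω := hsol y (fun j => (it j ω).1) e rfl
      (fun t => by simp only [he, hit, SGDM.iter, add_sub_cancel])
      (fun t => by simp only [hy, hit, SGDM.iter]; abel)
    refine tracking_induction (Y := fun j => ‖y j‖) ?_ (fun t => ?_) fun t ht hbd => ?_
    · -- at time zero the response bound says `‖y 1‖ ≤ (M / 4) ‖y 1‖`, that is `M ≥ 4` or `y 1 = 0`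
      have h := (hsolω 0).2
      simp only [Finset.Icc_eq_empty_of_lt zero_lt_one, Finset.sum_empty, smul_zero, add_zero,
        pow_zero, mul_one, zero_add] at h
      have hy1 : ‖y 1‖ = y₁ := rfl
      simp only [hR, pow_zero, mul_one, hQ, hy1]
      rw [hy1] at h
      have h' : y₁ ≤ M / 4 * y₁ := h
      have : 0 ≤ M * y₁ := by positivity
      linarith
    · exact Real.le_sqrt_of_sq_le (le_add_of_nonneg_left (sq_nonneg _))
    · have hmt : SGDM.mTildeSucc A γ xs (fun j => (it j ω).2) t =
          (1 - γ) • ∑ j ∈ Finset.Icc 1 t, γ ^ (t - j) • SGDM.op A (y j) := rfl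
      have hstep := sqrt_norm_sq_add_norm_sq_le (u := fun j => u j ω)
        (r := fun j => gradient (SGDM.meanLoss P f) (it j ω).2 - SGDM.op A (y j))
        (R := fun j => R (j - 1) ^ 2) hM.le hlam0.le hα.le hW₁ hW₂ (hsolω t).1 (hsolω t).2
        (fun j hj => ?_) (fun j hj => ?_) (hω t ht).1 (hω t ht).2
        (sum_pow_mul_sq_le hlam0 hlam1 hδ hδ1 hβ t) hLbar.le
      · rw [hmt]
        refine hstep.trans ?_
        have hbudget := error_budget (u := lam ^ t) (v := β ^ t) hlam1 hβ0 hβ1 hδ hδ1 hM hℓ hLf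
          hLbar hα hσ hb0 hs0 (norm_nonneg (x₁ - xs))
          (pow_le_pow_left₀ hlam0.le
            (by rw [hβ]; exact Real.self_le_rpow_of_le_one hlam0.le hlam1.le (by linarith)) t)
          (by positivity) hN hQ ?_ hinit
        · refine le_trans (le_of_eq ?_) hbudget
          have hy1 : ‖y 1‖ = ‖x₁ - xs‖ := rfl
          rw [hy1]
          simp only [hV]
          ring
        · have h1 : (1 - lam) ^ (1 / 2 : ℝ) = s := (Real.sqrt_eq_rpow _).symm
          have h2 : (1 - lam) ^ (3 / 2 : ℝ) = (1 - lam) * s := by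
            rw [← h1, show (3 / 2 : ℝ) = 1 + 1 / 2 by norm_num, Real.rpow_add hl, Real.rpow_one]
          rw [h1, h2] at hcond
          exact hcond
      · -- inside the tracking radius the truncation is inactive
        have htr : u j ω = gradient (SGDM.batchLoss f (fun i => ξ j i ω)) (it j ω).2 -
            gradient (SGDM.meanLoss P f) (it j ω).2 := by
          have hj' : ‖(it j ω).2 - xs‖ ≤ R (j - 1) := hbd j hj
          simp only [hu, hψ, batchAverage, truncatedNoise, if_pos hj']
          rw [gradient_batchLoss fun s => (hf s).1, Finset.sum_sub_distrib, smul_sub]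
          congr 1
          rw [Finset.sum_const, Finset.card_univ, Fintype.card_fin, ← Nat.cast_smul_eq_nsmul ℝ,
            smul_smul, one_div, inv_mul_cancel₀ hB0.ne', one_smul]
        simp only [htr, he]
        abel
      · have h := norm_gradient_sub_hessian_le hmean hLbar.le hxs0 hlipH (it j ω).2
        rw [← hAeq] at h
        refine h.trans ?_
        have hj' : ‖(it j ω).2 - xs‖ ≤ R (j - 1) := hbd j hj
        gcongr
  -- union bound over the two components and the `T` times
  set bad : (ℕ → SGDM.E d →L[ℝ] SGDM.E d) → ℕ → Set Ω := fun W t =>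
    {ω | 8 * V t * (4 * ℓ) ≤ ‖∑ j ∈ Finset.Icc 1 t, W (t - j) (u j ω)‖} with hbad
  set good : Set Ω := {ω | ∀ t ∈ Finset.Icc 1 T,
        √(‖SGDM.mTildeSucc A γ xs (fun j => (it j ω).2) t‖ ^ 2 +
          ‖(it (t + 1) ω).2 - xs‖ ^ 2) ≤ R t} with hgoodset
  have hcompl : goodᶜ ⊆ ⋃ t ∈ Finset.Icc 1 T, (bad W₁ t ∪ bad W₂ t) := by
    intro ω hω
    by_contra hc
    refine hω (hgood ω fun t ht => ?_)
    simp only [Set.mem_iUnion, not_exists, Set.mem_union, not_or] at hc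
    have h := hc t ht
    exact ⟨(not_le.mp h.1).le, (not_le.mp h.2).le⟩
  have hT0 : (0 : ℝ) < T := by exact_mod_cast hT
  have hbadle : Pr goodᶜ ≤ ENNReal.ofReal (2 / (T : ℝ)) := by
    calc Pr goodᶜ ≤ Pr (⋃ t ∈ Finset.Icc 1 T, (bad W₁ t ∪ bad W₂ t)) := measure_mono hcompl
      _ ≤ ∑ t ∈ Finset.Icc 1 T, Pr (bad W₁ t ∪ bad W₂ t) := measure_biUnion_finset_le _ _
      _ ≤ ∑ t ∈ Finset.Icc 1 T, ENNReal.ofReal (2 / (T : ℝ) ^ 2) := by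
          refine Finset.sum_le_sum fun t _ => (measure_union_le _ _).trans ?_
          refine (add_le_add (htail W₁ hW₁ t) (htail W₂ hW₂ t)).trans (le_of_eq ?_)
          rw [← ENNReal.ofReal_add (by positivity) (by positivity)]
          congr 1
          ring
      _ = ENNReal.ofReal (2 / (T : ℝ)) := by
          rw [Finset.sum_const, Nat.card_Icc, Nat.add_sub_cancel, nsmul_eq_mul,
            ← ENNReal.ofReal_natCast, ← ENNReal.ofReal_mul (by positivity)]
          congr 1
          field_simp
  -- `good` need not be measurable: subadditivity suffices for the lower bound
  have hprob : ENNReal.ofReal (1 - 2 / (T : ℝ)) ≤ Pr good := by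
    rw [ENNReal.ofReal_sub _ (by positivity), ENNReal.ofReal_one, tsub_le_iff_right]
    calc (1 : ℝ≥0∞) = Pr (good ∪ goodᶜ) := by rw [Set.union_compl_self, measure_univ]
      _ ≤ Pr good + Pr goodᶜ := measure_union_le _ _
      _ ≤ _ := by gcongr
  refine hprob.trans (measure_mono fun ω hω t ht => ?_)
  refine (hω t ht).trans (le_of_eq ?_)
  simp only [hR, hN, hQ, hβ]
  rw [Real.sqrt_mul hB0.le, ← Real.rpow_natCast, ← Real.rpow_mul hlam0.le]
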